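/- Let $Y$ be a real Banach space. Let ${\mathrm{Lip}}_0(\mathbb{R},Y)$ be the space of all Lipschitz maps $f\colon\mathbb{R}\to Y$ with $f(0)=0$, endowed with the norm $$\|f\|=\sup\left\{\frac{\|f(s)-f(t)\|}{|s-t|}\colon s,t\in\mathbb{R},\ s\neq t\right\},$$ and let $\mathrm{D}(\mathbb{R},Y)$ be the set of all $f\in{\mathrm{Lip}}_0(\mathbb{R},Y)$ that attain their norm through a derivative, that is, for which there are $x\in\mathbb{R}$ and $e\in\{-1,1\}$ such that the limit $$f'(x,e)=\lim_{t\to0}\frac{f(x+te)-f(x)}{t}$$ exists in $Y$ and satisfies $\|f'(x,e)\|=\|f\|$. Then the following are equivalent: (i) $Y$ has the Radon–Nikodým property: for every finite measure space $(\Omega,\Sigma,\mu)$ and every countably additive vector measure $G\colon\Sigma\to Y$ of bounded variation that vanishes on all $\mu$-null sets, there is a Bochner integrable function $g\colon\Omega\to Y$ with $G(E)=\int_E g\,d\mu$ for every $E\in\Sigma$. (ii) $\mathrm{D}(\mathbb{R},Y)$ is dense in ${\mathrm{Lip}}_0(\mathbb{R},Y)$. (iii) The set of all $f\in{\mathrm{Lip}}_0(\mathbb{R},Y)$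 for which $$f'(t)=\lim_{h\to0}\frac{f(t+h)-f(t)}{h}$$ exists for some $t\in\mathbb{R}$ is dense in ${\mathrm{Lip}}_0(\mathbb{R},Y)$. -/

import Mathlib

open MeasureTheory
open scoped NNReal ENNReal

universe u v

/-- A real Banach space `Y` has the Radon–Nikodým property if for every finite measure space
`(Ω, Σ, μ)` and every countably additive vector measure `G : Σ → Y` of bounded variation that is
absolutely continuous with respect to `μ` there is a Bochner integrable `g : Ω → Y` such that
`G E = ∫_E g dμ` for all `E ∈ Σ`. The measure spaces range over all types in the universe `v`. -/
def HasRadonNikodymProperty (Y : Type u) [NormedAddCommGroup Y] [NormedSpace ℝ Y] : Prop :=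
  ∀ (Ω : Type v) [MeasurableSpace Ω] (μ : Measure Ω) [IsFiniteMeasure μ] (G : VectorMeasure Ω Y),
    G.variation Set.univ < ∞ →
    (∀ E : Set Ω, MeasurableSet E → μ E = 0 → G E = 0) →
    ∃ g : Ω → Y, Integrable g μ ∧ ∀ E : Set Ω, MeasurableSet E → G E = ∫ ω in E, g ω ∂μ

/-- The space `Lip₀(X, Y)` of all Lipschitz maps `f : X → Y` with `f 0 = 0`. -/
structure LipZero (X : Type u) (Y : Type v) [NormedAddCommGroup X] [NormedAddCommGroup Y] where
  /-- the underlying map -/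
  toFun : X → Y
  exists_lipschitzWith : ∃ K : ℝ≥0, LipschitzWith K toFun
  map_zero : toFun 0 = 0

namespace LipZero

section

variable {X : Type u} {Y : Type v} [NormedAddCommGroup X] [NormedAddCommGroup Y]

instance : CoeFun (LipZero X Y) (fun _ => X → Y) := ⟨LipZero.toFun⟩

@[ext] theorem ext {f g : LipZero X Y} (h : ∀ x, f x = g x) : f = g := by
  cases f
  cases g
  congr
  exact funext h

instance : Zero (LipZero X Y) := ⟨⟨fun _ => 0, ⟨0, LipschitzWith.const 0⟩, rfl⟩⟩

instance : Add (LipZero X Y) :=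
  ⟨fun f g => ⟨fun x => f x + g x, by
    obtain ⟨K, hK⟩ := f.exists_lipschitzWith
    obtain ⟨L, hL⟩ := g.exists_lipschitzWith
    exact ⟨K + L, hK.add hL⟩, by simp [f.map_zero, g.map_zero]⟩⟩

instance : Neg (LipZero X Y) :=
  ⟨fun f => ⟨fun x => -f x, by
    obtain ⟨K, hK⟩ := f.exists_lipschitzWith
    exact ⟨K, hK.neg⟩, by simp [f.map_zero]⟩⟩

@[simp] theorem zero_apply (x : X) : (0 : LipZero X Y) x = 0 := rfl

@[simp] theorem add_apply (f g : LipZero X Y) (x : X) : (f + g) x = f x + g x := rfl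

@[simp] theorem neg_apply (f : LipZero X Y) (x : X) : (-f) x = -f x := rfl

instance : AddCommGroup (LipZero X Y) where
  add_assoc _ _ _ := ext fun _ => add_assoc _ _ _
  zero_add _ := ext fun _ => zero_add _
  add_zero _ := ext fun _ => add_zero _
  add_comm _ _ := ext fun _ => add_comm _ _
  neg_add_cancel _ := ext fun _ => neg_add_cancel _
  nsmul := nsmulRec
  zsmul := zsmulRec

@[simp] theorem sub_apply (f g : LipZero X Y) (x : X) : (f - g) x = f x - g x := by
  rw [sub_eq_add_neg, add_apply, neg_apply, sub_eq_add_neg]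

/-- The Lipschitz norm `‖f‖ = sup {‖f x - f y‖ / ‖x - y‖ : x ≠ y}`. -/
noncomputable instance : Norm (LipZero X Y) :=
  ⟨fun f => sSup {r : ℝ | ∃ x y : X, x ≠ y ∧ r = ‖f x - f y‖ / ‖x - y‖}⟩

theorem norm_def (f : LipZero X Y) :
    ‖f‖ = sSup {r : ℝ | ∃ x y : X, x ≠ y ∧ r = ‖f x - f y‖ / ‖x - y‖} := rfl

theorem norm_nonneg' (f : LipZero X Y) : 0 ≤ ‖f‖ := by
  refine Real.sSup_nonneg ?_
  rintro r ⟨x, y, -, rfl⟩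
  positivity

theorem norm_sub_le_mul (f : LipZero X Y) (x y : X) : ‖f x - f y‖ ≤ ‖f‖ * ‖x - y‖ := by
  by_cases hxy : x = y
  · simp [hxy]
  have hpos : 0 < ‖x - y‖ := norm_pos_iff.2 (sub_ne_zero.2 hxy)
  rw [← div_le_iff₀ hpos]
  refine le_csSup ?_ ⟨x, y, hxy, rfl⟩
  obtain ⟨K, hK⟩ := f.exists_lipschitzWith
  refine ⟨K, ?_⟩
  rintro r ⟨a, b, hab, rfl⟩
  rw [div_le_iff₀ (norm_pos_iff.2 (sub_ne_zero.2 hab))]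
  exact hK.norm_sub_le a b

theorem norm_le_of_forall (f : LipZero X Y) {C : ℝ} (hC : 0 ≤ C)
    (h : ∀ x y : X, ‖f x - f y‖ ≤ C * ‖x - y‖) : ‖f‖ ≤ C := by
  refine Real.sSup_le ?_ hC
  rintro r ⟨x, y, hxy, rfl⟩
  rw [div_le_iff₀ (norm_pos_iff.2 (sub_ne_zero.2 hxy))]
  exact h x y

variable [NormedSpace ℝ Y]

instance : SMul ℝ (LipZero X Y) :=
  ⟨fun c f => ⟨fun x => c • f x, by
    obtain ⟨K, hK⟩ := f.exists_lipschitzWith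
    exact ⟨‖c‖₊ * K, (lipschitzWith_smul c).comp hK⟩, by simp [f.map_zero]⟩⟩

@[simp] theorem smul_apply (c : ℝ) (f : LipZero X Y) (x : X) : (c • f) x = c • f x := rfl

instance : Module ℝ (LipZero X Y) where
  one_smul _ := ext fun _ => one_smul _ _
  mul_smul _ _ _ := ext fun _ => mul_smul _ _ _
  smul_zero _ := ext fun _ => smul_zero _
  smul_add _ _ _ := ext fun _ => smul_add _ _ _
  add_smul _ _ _ := ext fun _ => add_smul _ _ _
  zero_smul _ := ext fun _ => zero_smul _ _

theorem normedSpaceCore : NormedSpace.Core ℝ (LipZero X Y) where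
  norm_nonneg f := norm_nonneg' f
  norm_smul c f := by
    have key : ∀ (a : ℝ) (g : LipZero X Y), ‖a • g‖ ≤ ‖a‖ * ‖g‖ := fun a g => by
      refine norm_le_of_forall _ (mul_nonneg (norm_nonneg a) (norm_nonneg' g)) fun x y => ?_
      rw [smul_apply, smul_apply, ← smul_sub, norm_smul, mul_assoc]
      exact mul_le_mul_of_nonneg_left (norm_sub_le_mul g x y) (norm_nonneg a)
    refine le_antisymm (key c f) ?_
    by_cases hc : c = 0
    · subst hc
      simpa using norm_nonneg' ((0 : ℝ) • f)
    · have h := key c⁻¹ (c • f)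
      rw [smul_smul, inv_mul_cancel₀ hc, one_smul, norm_inv] at h
      have hc' : 0 < ‖c‖ := norm_pos_iff.2 hc
      calc ‖c‖ * ‖f‖ ≤ ‖c‖ * (‖c‖⁻¹ * ‖c • f‖) := mul_le_mul_of_nonneg_left h hc'.le
        _ = ‖c • f‖ := by rw [← mul_assoc, mul_inv_cancel₀ hc'.ne', one_mul]
  norm_triangle f g := by
    refine norm_le_of_forall _ (add_nonneg (norm_nonneg' f) (norm_nonneg' g)) fun x y => ?_
    rw [add_apply, add_apply, add_sub_add_comm, add_mul]
    exact (norm_add_le _ _).trans (add_le_add (norm_sub_le_mul f x y) (norm_sub_le_mul g x y))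
  norm_eq_zero_iff f := by
    constructor
    · intro h
      ext x
      have hx := norm_sub_le_mul f x 0
      rw [h, zero_mul, f.map_zero, sub_zero] at hx
      exact norm_le_zero_iff.1 hx
    · rintro rfl
      refine le_antisymm (norm_le_of_forall _ le_rfl fun x y => ?_) (norm_nonneg' _)
      simp

noncomputable instance : NormedAddCommGroup (LipZero X Y) :=
  NormedAddCommGroup.ofCore normedSpaceCore

noncomputable instance : NormedSpace ℝ (LipZero X Y) :=
  NormedSpace.ofCore normedSpaceCore

end

/-- `f` attains its norm at `x` through a derivative in the direction `e`: the directional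
derivative `z = lim_{t → 0} (f (x + t e) - f x) / t` exists in `Y` and satisfies `‖z‖ = ‖f‖`. -/
def AttainsNormThroughDerivAt {X : Type u} {Y : Type v} [NormedAddCommGroup X] [NormedSpace ℝ X]
    [NormedAddCommGroup Y] [NormedSpace ℝ Y] (f : LipZero X Y) (x e : X) : Prop :=
  ∃ z : Y, HasLineDerivAt ℝ f z x e ∧ ‖z‖ = ‖f‖

/-- The set `D(X, Y)` of all `f ∈ Lip₀(X, Y)` that attain their norm at some point of `X` through
a derivative in the direction of some unit vector of `X`. -/
def derivAttaining (X : Type u) (Y : Type v) [NormedAddCommGroup X] [NormedSpace ℝ X]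
    [NormedAddCommGroup Y] [NormedSpace ℝ Y] : Set (LipZero X Y) :=
  {f | ∃ x e : X, ‖e‖ = 1 ∧ f.AttainsNormThroughDerivAt x e}

end LipZero

/-! (i) ⇒ (ii): choose `[a, b]` over which the slope of `f` is almost `‖f‖`. The Radon–Nikodým
property gives `f` a density `g` there (`HasRadonNikodymProperty.exists_density`), which has norm
almost `‖f‖` on a non-null set and, having separable range, is nearly constant on a non-null subset
`B`. Replacing `g` on `B` by a nearby vector `z` of norm slightly above `‖f‖` changes `f` little in
the Lipschitz norm; the new norm is `‖z‖`, attained as a derivative at almost every point of `B`. On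
the line, (ii) ⇒ (iii) is immediate.

(iii) ⇒ (i): let `ν` be the variation of `G`. If for every `ε` each non-null set has a non-null
subset on which the averages of `G` stay within `ε` of one vector, exhaustion yields step functions
approximating the density of `G`, and they converge in `L¹`. If this fails, then after conditioning
every non-null set contains, for each `y`, a subset whose average is more than `ε` from `y`.
Iterated exhaustion gives a tree of nested sets whose averages jump by more than `ε` from each node
to its child. Parametrising the tree by `ν`-measure turns `G` into a Lipschitz function on `[0, 1]`,
extended by tiling to the line, whose slopes over intervals shrinking to any point keep jumping. By
the straddle lemma no function close to it in `Lip₀` is differentiable anywhere, against density. -/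

/-! ### Exhaustion by disjoint non-null sets -/

section Exhaustion

variable {Ω : Type*} [MeasurableSpace Ω]

/-- Method of exhaustion: if every non-null measurable subset of `D` contains a non-null measurable
set satisfying `P`, then `D` is, up to a null set, a countable disjoint union of such sets. -/
theorem exists_seq_disjoint_exhausting (μ : Measure Ω) [SFinite μ] {P : Set Ω → Prop} {D : Set Ω}
    (hD : MeasurableSet D)
    (h : ∀ E ⊆ D, MeasurableSet E → μ E ≠ 0 → ∃ F ⊆ E, MeasurableSet F ∧ μ F ≠ 0 ∧ P F) :
    ∃ F : ℕ → Set Ω, (∀ i, MeasurableSet (F i)) ∧ Pairwise (Function.onFun Disjoint F) ∧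
      (∀ i, F i ⊆ D) ∧ (∀ i, F i = ∅ ∨ P (F i)) ∧ μ (D \ ⋃ i, F i) = 0 := by
  obtain ⟨S, hS⟩ := zorn_subset
    {S : Set (Set Ω) | (∀ F ∈ S, MeasurableSet F ∧ μ F ≠ 0 ∧ F ⊆ D ∧ P F) ∧ S.PairwiseDisjoint id} (by
      intro c hc hchain
      refine ⟨⋃₀ c, ⟨?_, ?_⟩, fun s hs => Set.subset_sUnion_of_mem hs⟩
      · rintro F ⟨s, hs, hF⟩
        exact (hc hs).1 F hF
      · exact (Set.pairwiseDisjoint_sUnion hchain.directedOn).2 fun s hs => (hc hs).2)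
  obtain ⟨⟨hSP, hSd⟩, hmax⟩ := hS
  have hSc : S.Countable := by
    have := Measure.countable_meas_pos_of_disjoint_iUnion (μ := μ) (As := fun F : S => (F : Set Ω))
      (fun F => (hSP F F.2).1) (fun F F' hne => hSd F.2 F'.2 (fun e => hne (Subtype.ext e)))
    have huniv : {F : S | 0 < μ (F : Set Ω)} = Set.univ :=
      Set.eq_univ_of_forall fun F => pos_iff_ne_zero.2 (hSP F F.2).2.1
    rw [huniv] at this
    exact Set.countable_coe_iff.1 (Set.countable_univ_iff.1 this)
  have := hSc.toEncodable
  -- The maximal family may be finite, so its enumeration is padded with empty sets.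
  have hU : (⋃ i, ⋃ F ∈ Encodable.decode₂ S i, (F : Set Ω)) = ⋃ F : S, (F : Set Ω) :=
    Encodable.iUnion_decode₂ _
  refine ⟨fun i => ⋃ F ∈ Encodable.decode₂ S i, (F : Set Ω), fun i => ?_,
    Encodable.iUnion_decode₂_disjoint_on fun F F' hne => hSd F.2 F'.2 fun e => hne (Subtype.ext e),
    fun i => ?_, fun i => ?_, ?_⟩
  · exact Encodable.iUnion_decode₂_cases (β := S) (f := Subtype.val) (C := MeasurableSet) MeasurableSet.empty
      fun F => (hSP F F.2).1
  · exact Encodable.iUnion_decode₂_cases (β := S) (f := Subtype.val) (C := (· ⊆ D)) (Set.empty_subset _)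
      fun F => (hSP F F.2).2.2.1
  · exact Encodable.iUnion_decode₂_cases (β := S) (f := Subtype.val) (C := fun s => s = ∅ ∨ P s) (Or.inl rfl)
      fun F => Or.inr (hSP F F.2).2.2.2
  · rw [hU]
    -- A non-null remainder contains an admissible set disjoint from every member of `S`. Maximality
    -- puts that set in `S`, so it is disjoint from itself.
    by_contra hne
    obtain ⟨F, hFE, hFm, hF0, hFP⟩ := h _ Set.sdiff_subset
      (hD.diff (MeasurableSet.iUnion fun F : S => (hSP F F.2).1)) hne
    have hdisj : ∀ F' ∈ S, Disjoint F F' := fun F' hF' =>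
      Set.disjoint_left.2 fun x hx hx' => (hFE hx).2 (Set.mem_iUnion.2 ⟨⟨F', hF'⟩, hx'⟩)
    have hmem : F ∈ S := hmax (y := insert F S) ⟨by
        rintro F' (rfl | hF')
        · exact ⟨hFm, hF0, hFE.trans Set.sdiff_subset, hFP⟩
        · exact hSP F' hF',
      (Set.pairwiseDisjoint_insert.2 ⟨hSd, fun F' hF' _ => hdisj F' hF'⟩)⟩
      (Set.subset_insert _ _) (Set.mem_insert _ _)
    have := hdisj F hmem
    rw [disjoint_self] at this
    exact hF0 (by simp_all)

end Exhaustion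

/-! ### The tree of sets with jumping averages -/

section Tree

variable {Ω : Type*} [MeasurableSpace Ω] {Y : Type*} [NormedAddCommGroup Y] [NormedSpace ℝ Y]

/-- The average value of the vector measure `G` with respect to `ν` on `B \ A`, where `A ⊆ B`. -/
noncomputable def averageRate (G : VectorMeasure Ω Y) (ν : Measure Ω) (A B : Set Ω) : Y :=
  (ν.real B - ν.real A)⁻¹ • (G B - G A)

/-- An increasing sequence of sets exhausting `B` from `A`, on each of whose non-null steps the
average of `G` differs from its average on `B \ A` by more than `ε`. -/
structure IsGapChain (G : VectorMeasure Ω Y) (ν : Measure Ω) (ε : ℝ) (A B : Set Ω)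
    (C : ℕ → Set Ω) : Prop where
  measurableSet : ∀ i, MeasurableSet (C i)
  monotone : Monotone C
  zero : C 0 = A
  subset : ∀ i, C i ⊆ B
  exists_lt : ∀ t < ν.real B, ∃ i, t < ν.real (C i)
  gap : ∀ i, ν.real (C i) < ν.real (C (i + 1)) →
    ε < ‖averageRate G ν (C i) (C (i + 1)) - averageRate G ν A B‖

/-- Exhaust `B \ A` by disjoint sets whose averages are far from that of `B \ A`; adding them to `A`
one at a time gives the chain. -/
theorem exists_isGapChain {G : VectorMeasure Ω Y} {ν : Measure Ω} [IsFiniteMeasure ν] {ε : ℝ}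
    (hG : ∀ E, MeasurableSet E → ‖G E‖ ≤ ν.real E)
    (hbad : ∀ E, MeasurableSet E → ν E ≠ 0 → ∀ y : Y,
      ∃ F ⊆ E, MeasurableSet F ∧ ε * ν.real F < ‖G F - ν.real F • y‖)
    {A B : Set Ω} (hA : MeasurableSet A) (hB : MeasurableSet B) (hAB : A ⊆ B) :
    ∃ C, IsGapChain G ν ε A B C := by
  obtain ⟨F, hFm, hFd, hFD, hFP, hF0⟩ := exists_seq_disjoint_exhausting ν
    (P := fun F => ε * ν.real F < ‖G F - ν.real F • averageRate G ν A B‖) (hB.diff hA) (by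
      intro E _ hE hE0
      obtain ⟨F, hFE, hFm, hF⟩ := hbad E hE hE0 (averageRate G ν A B)
      -- On a null set domination by `ν` forces `G F = 0`, contradicting the strict inequality.
      refine ⟨F, hFE, hFm, fun h0 => ?_, hF⟩
      have h0' : ν.real F = 0 := by simp [Measure.real, h0]
      have := hG F hFm
      rw [h0'] at this hF
      simp [norm_le_zero_iff.1 this] at hF)
  have hstep : ∀ i, (A ∪ ⋃ j < i + 1, F j) = (A ∪ ⋃ j < i, F j) ∪ F i := fun i => by
    rw [Set.biUnion_lt_succ, Set.union_assoc]
  have hm : ∀ i, MeasurableSet (A ∪ ⋃ j < i, F j) := fun i =>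
    hA.union (MeasurableSet.biUnion (Set.to_countable _) fun j _ => hFm j)
  have hmono : Monotone fun i => A ∪ ⋃ j < i, F j := fun i k hik =>
    Set.union_subset_union_right _ (Set.biUnion_mono (fun j hj => lt_of_lt_of_le hj hik) fun _ _ => le_rfl)
  have hdisj : ∀ i, Disjoint (A ∪ ⋃ j < i, F j) (F i) := fun i => by
    refine Set.disjoint_union_left.2 ⟨Set.disjoint_left.2 fun x hx hx' => (hFD i hx').2 hx, ?_⟩
    refine Set.disjoint_iUnion₂_left.2 fun j hj => hFd hj.ne
  have hsub : ∀ i, (A ∪ ⋃ j < i, F j) ⊆ B := fun i =>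
    Set.union_subset hAB (Set.iUnion₂_subset fun j _ => (hFD j).trans Set.sdiff_subset)
  refine ⟨fun i => A ∪ ⋃ j < i, F j, hm, hmono, by simp, hsub, ?_, ?_⟩
  · intro t ht
    have hlim := tendsto_measure_iUnion_atTop (μ := ν) hmono
    have hU : ν (⋃ i, (A ∪ ⋃ j < i, F j)) = ν B := by
      refine le_antisymm (measure_mono (Set.iUnion_subset hsub)) ?_
      have hcov : B ⊆ (⋃ i, (A ∪ ⋃ j < i, F j)) ∪ ((B \ A) \ ⋃ i, F i) := by
        intro x hx
        by_cases hxA : x ∈ A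
        · exact Or.inl (Set.mem_iUnion.2 ⟨0, Or.inl hxA⟩)
        by_cases hxF : x ∈ ⋃ i, F i
        · obtain ⟨i, hi⟩ := Set.mem_iUnion.1 hxF
          exact Or.inl (Set.mem_iUnion.2
            ⟨i + 1, Or.inr (Set.mem_iUnion₂.2 ⟨i, Nat.lt_succ_self i, hi⟩)⟩)
        · exact Or.inr ⟨⟨hx, hxA⟩, hxF⟩
      refine (measure_mono hcov).trans ((measure_union_le _ _).trans ?_)
      rw [hF0, add_zero]
    rw [hU] at hlim
    have hlim' := (ENNReal.tendsto_toReal (measure_ne_top ν B)).comp hlim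
    exact (hlim'.eventually (lt_mem_nhds ht)).exists
  · intro i hi
    simp only [hstep] at hi ⊢
    have hν : ν.real ((A ∪ ⋃ j < i, F j) ∪ F i) = ν.real (A ∪ ⋃ j < i, F j) + ν.real (F i) :=
      measureReal_union (hdisj i) (hFm i)
    have hGu := G.of_union (hdisj i) (hm i) (hFm i)
    have hpos : 0 < ν.real (F i) := by linarith
    rcases hFP i with h | h
    · simp [h] at hpos
    have key : averageRate G ν (A ∪ ⋃ j < i, F j) ((A ∪ ⋃ j < i, F j) ∪ F i)
        = (ν.real (F i))⁻¹ • G (F i) := by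
      rw [averageRate, hν, hGu, add_sub_cancel_left, add_sub_cancel_left]
    rw [key]
    have : (ν.real (F i))⁻¹ • G (F i) - averageRate G ν A B
        = (ν.real (F i))⁻¹ • (G (F i) - ν.real (F i) • averageRate G ν A B) := by
      rw [smul_sub, inv_smul_smul₀ hpos.ne']
    rw [this, norm_smul, norm_inv, Real.norm_of_nonneg hpos.le, inv_mul_eq_div, lt_div_iff₀ hpos]
    exact h

/-- The nodes containing `t` of the tree of sets obtained by iterated refinement: starting from
`(∅, univ)`, a node `(A, B)` is followed by the step of the chain `C A B` that contains `t`. -/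
noncomputable def treeNode (ν : Measure Ω) (C : Set Ω → Set Ω → ℕ → Set Ω) (t : ℝ) :
    ℕ → Set Ω × Set Ω
  | 0 => (∅, Set.univ)
  | n + 1 =>
    let c := C (treeNode ν C t n).1 (treeNode ν C t n).2
    (c (sInf {i | t < ν.real (c (i + 1))}), c (sInf {i | t < ν.real (c (i + 1))} + 1))

variable {G : VectorMeasure Ω Y} {ν : Measure Ω} {ε : ℝ} {C : Set Ω → Set Ω → ℕ → Set Ω}

/-- Every pair of nested measurable sets is refined by a gap chain. -/
def IsGapSystem (G : VectorMeasure Ω Y) (ν : Measure Ω) (ε : ℝ)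
    (C : Set Ω → Set Ω → ℕ → Set Ω) : Prop :=
  ∀ A B, MeasurableSet A → MeasurableSet B → A ⊆ B → IsGapChain G ν ε A B (C A B)

/-- `p` is a pair of nested measurable sets between whose measures `t` lies. -/
structure IsNodeAt (ν : Measure Ω) (t : ℝ) (p : Set Ω × Set Ω) : Prop where
  measurableSet_fst : MeasurableSet p.1
  measurableSet_snd : MeasurableSet p.2
  subset : p.1 ⊆ p.2
  le : ν.real p.1 ≤ t
  lt : t < ν.real p.2

namespace IsGapChain

variable {A B : Set Ω} {c : ℕ → Set Ω} {t : ℝ}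

theorem lt_index [IsFiniteMeasure ν] (hc : IsGapChain G ν ε A B c) (ht : t < ν.real B) :
    t < ν.real (c (sInf {i | t < ν.real (c (i + 1))} + 1)) := by
  have hne : {i | t < ν.real (c (i + 1))}.Nonempty := by
    obtain ⟨i, hi⟩ := hc.exists_lt t ht
    exact ⟨i, hi.trans_le (measureReal_mono (hc.monotone i.le_succ))⟩
  exact Nat.sInf_mem hne

theorem index_le (hc : IsGapChain G ν ε A B c) (ht : ν.real A ≤ t) :
    ν.real (c (sInf {i | t < ν.real (c (i + 1))})) ≤ t := by
  rcases Nat.eq_zero_or_pos (sInf {i | t < ν.real (c (i + 1))}) with h | h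
  · rw [h, hc.zero]
    exact ht
  · have := Nat.notMem_of_lt_sInf (Nat.sub_one_lt_of_lt h)
    rw [Set.mem_ofPred_eq, Nat.sub_add_cancel (Nat.one_le_of_lt h)] at this
    exact not_lt.1 this

theorem isNodeAt [IsFiniteMeasure ν] (hc : IsGapChain G ν ε A B c) (hle : ν.real A ≤ t)
    (hlt : t < ν.real B) :
    IsNodeAt ν t (c (sInf {i | t < ν.real (c (i + 1))}), c (sInf {i | t < ν.real (c (i + 1))} + 1)) where
  measurableSet_fst := hc.measurableSet _
  measurableSet_snd := hc.measurableSet _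
  subset := hc.monotone (Nat.le_succ _)
  le := hc.index_le hle
  lt := hc.lt_index hlt

end IsGapChain

section

variable [IsProbabilityMeasure ν] {s t : ℝ}

theorem isNodeAt_treeNode (hC : IsGapSystem G ν ε C) (h0 : 0 ≤ t) (h1 : t < 1) (n : ℕ) :
    IsNodeAt ν t (treeNode ν C t n) := by
  induction n with
  | zero => exact ⟨MeasurableSet.empty, MeasurableSet.univ, Set.empty_subset _, by simpa [treeNode],
      by simpa [treeNode]⟩
  | succ n ih =>
    exact (hC _ _ ih.1 ih.2 ih.3).isNodeAt ih.4 ih.5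

theorem monotone_treeNode_fst (hC : IsGapSystem G ν ε C) (h0 : 0 ≤ t) (h1 : t < 1) :
    Monotone fun n => (treeNode ν C t n).1 := by
  refine monotone_nat_of_le_succ fun n => ?_
  have hn := isNodeAt_treeNode hC h0 h1 n
  have hc := hC _ _ hn.1 hn.2 hn.3
  conv_lhs => rw [← hc.zero]
  exact hc.monotone (Nat.zero_le _)

theorem antitone_treeNode_snd (hC : IsGapSystem G ν ε C) (h0 : 0 ≤ t) (h1 : t < 1) :
    Antitone fun n => (treeNode ν C t n).2 := by
  refine antitone_nat_of_succ_le fun n => ?_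
  have hn := isNodeAt_treeNode hC h0 h1 n
  exact (hC _ _ hn.1 hn.2 hn.3).subset _

theorem lt_norm_averageRate_treeNode_sub (hC : IsGapSystem G ν ε C) (h0 : 0 ≤ t) (h1 : t < 1)
    (n : ℕ) : ε < ‖averageRate G ν (treeNode ν C t (n + 1)).1 (treeNode ν C t (n + 1)).2
      - averageRate G ν (treeNode ν C t n).1 (treeNode ν C t n).2‖ := by
  have hn := isNodeAt_treeNode hC h0 h1 n
  have hn' := isNodeAt_treeNode hC h0 h1 (n + 1)
  exact (hC _ _ hn.1 hn.2 hn.3).gap _ (hn'.4.trans_lt hn'.5)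

/-- As long as two parameters share a node they select steps of one chain, in order; once they are
separated, nestedness keeps them so. -/
theorem treeNode_eq_or_subset (hC : IsGapSystem G ν ε C) (h0 : 0 ≤ s) (hst : s < t) (h1 : t < 1)
    (n : ℕ) : treeNode ν C s n = treeNode ν C t n ∨
      (treeNode ν C s n).2 ⊆ (treeNode ν C t n).1 := by
  induction n with
  | zero => exact Or.inl rfl
  | succ n ih =>
    rcases ih with ih | ih
    · have hn := isNodeAt_treeNode hC (h0.trans hst.le) h1 n
      have hc := hC _ _ hn.1 hn.2 hn.3
      have hs : treeNode ν C s (n + 1) = (C (treeNode ν C t n).1 (treeNode ν C t n).2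
            (sInf {i | s < ν.real (C (treeNode ν C t n).1 (treeNode ν C t n).2 (i + 1))}),
          C (treeNode ν C t n).1 (treeNode ν C t n).2
            (sInf {i | s < ν.real (C (treeNode ν C t n).1 (treeNode ν C t n).2 (i + 1))} + 1)) := by
        rw [← ih]
        rfl
      have hle : sInf {i | s < ν.real (C (treeNode ν C t n).1 (treeNode ν C t n).2 (i + 1))}
          ≤ sInf {i | t < ν.real (C (treeNode ν C t n).1 (treeNode ν C t n).2 (i + 1))} :=
        Nat.sInf_le (hst.trans (hc.lt_index hn.5))
      rcases hle.eq_or_lt with h | h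
      · left
        rw [hs, h]
        rfl
      · right
        rw [hs]
        exact hc.monotone h
    · exact Or.inr (((antitone_treeNode_snd hC h0 (hst.trans h1) n.le_succ).trans ih).trans
        (monotone_treeNode_fst hC (h0.trans hst.le) h1 n.le_succ))

omit [NormedSpace ℝ Y] in
theorem norm_sub_le_measureReal_sub (hG : ∀ E, MeasurableSet E → ‖G E‖ ≤ ν.real E) {A B : Set Ω}
    (hA : MeasurableSet A) (hB : MeasurableSet B) (hAB : A ⊆ B) :
    ‖G B - G A‖ ≤ ν.real B - ν.real A := by
  rw [← G.of_sdiff hA hB hAB, ← measureReal_sdiff hAB hA]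
  exact hG _ (hB.diff hA)

/-- If a gap of positive measure remained in the limit, countable additivity of `G` and `ν` would
make the averages converge, which jumps larger than `ε` exclude. -/
theorem tendsto_measureReal_treeNode (hε : 0 < ε)
    (hC : IsGapSystem G ν ε C) (h0 : 0 ≤ t) (h1 : t < 1) :
    Filter.Tendsto (fun n => ν.real (treeNode ν C t n).1) Filter.atTop (nhds t) ∧
    Filter.Tendsto (fun n => ν.real (treeNode ν C t n).2) Filter.atTop (nhds t) := by
  have hn := isNodeAt_treeNode hC h0 h1
  have hmono := monotone_treeNode_fst hC h0 h1
  have hanti := antitone_treeNode_snd hC h0 h1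
  have ha := (ENNReal.tendsto_toReal (measure_ne_top ν _)).comp
    (tendsto_measure_iUnion_atTop (μ := ν) hmono)
  have hb := (ENNReal.tendsto_toReal (measure_ne_top ν _)).comp
    (tendsto_measure_iInter_atTop (μ := ν) (fun n => (hn n).2.nullMeasurableSet) hanti
      ⟨0, measure_ne_top _ _⟩)
  have hGa := G.tendsto_vectorMeasure_iUnion_atTop_nat hmono fun n => (hn n).1
  have hGb := G.tendsto_vectorMeasure_iInter_atTop_nat hanti fun n => (hn n).2
  change Filter.Tendsto (fun n => ν.real (treeNode ν C t n).1) _ (nhds (ν.real _)) at ha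
  change Filter.Tendsto (fun n => ν.real (treeNode ν C t n).2) _ (nhds (ν.real _)) at hb
  have hla := le_of_tendsto' ha fun n => (hn n).4
  have hlb := ge_of_tendsto' hb fun n => (hn n).5.le
  have hab : ν.real (⋂ n, (treeNode ν C t n).2) - ν.real (⋃ n, (treeNode ν C t n).1) = 0 := by
    by_contra hne
    have hq : Filter.Tendsto
        (fun n => averageRate G ν (treeNode ν C t n).1 (treeNode ν C t n).2) Filter.atTop
        (nhds _) := ((hb.sub ha).inv₀ hne).smul (hGb.sub hGa)
    have hd := ((hq.comp (Filter.tendsto_add_atTop_nat 1)).sub hq).norm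
    rw [sub_self, norm_zero] at hd
    obtain ⟨n, hn⟩ := (hd.eventually (gt_mem_nhds hε)).exists
    exact lt_asymm hn (lt_norm_averageRate_treeNode_sub hC h0 h1 n)
  constructor
  · convert ha using 2
    linarith
  · convert hb using 2
    linarith

/-- The increasing family of sets, with `ν (treeSet ν C t) = t`, given by the tree. -/
noncomputable def treeSet (ν : Measure Ω) (C : Set Ω → Set Ω → ℕ → Set Ω) (t : ℝ) : Set Ω :=
  if t < 1 then ⋃ n, (treeNode ν C t n).1 else Set.univ

theorem measurableSet_treeSet (hC : IsGapSystem G ν ε C) (h0 : 0 ≤ t) :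
    MeasurableSet (treeSet ν C t) := by
  unfold treeSet
  split_ifs with h1
  · exact MeasurableSet.iUnion fun n => (isNodeAt_treeNode hC h0 h1 n).1
  · exact MeasurableSet.univ

theorem treeSet_mono (hC : IsGapSystem G ν ε C) (h0 : 0 ≤ s) (hst : s ≤ t) :
    treeSet ν C s ⊆ treeSet ν C t := by
  rcases hst.eq_or_lt with rfl | hst
  · exact le_rfl
  unfold treeSet
  by_cases h1 : t < 1
  · rw [if_pos h1, if_pos (hst.trans h1)]
    refine Set.iUnion_mono fun n => ?_
    rcases treeNode_eq_or_subset hC h0 hst h1 n with h | h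
    · rw [h]
    · exact (isNodeAt_treeNode hC h0 (hst.trans h1) n).3.trans h
  · rw [if_neg h1]
    exact Set.subset_univ _

theorem measureReal_treeSet (hε : 0 < ε)
    (hC : IsGapSystem G ν ε C) (h0 : 0 ≤ t) (h1 : t ≤ 1) : ν.real (treeSet ν C t) = t := by
  unfold treeSet
  split_ifs with h
  · have ha := (ENNReal.tendsto_toReal (measure_ne_top ν _)).comp
      (tendsto_measure_iUnion_atTop (μ := ν) (monotone_treeNode_fst hC h0 h))
    exact tendsto_nhds_unique ha (tendsto_measureReal_treeNode hε hC h0 h).1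
  · simp only [probReal_univ]
    exact le_antisymm (not_lt.1 h) h1

omit [NormedSpace ℝ Y] in
theorem eq_of_subset_of_measureReal_eq (hG : ∀ E, MeasurableSet E → ‖G E‖ ≤ ν.real E) {A B : Set Ω}
    (hA : MeasurableSet A) (hB : MeasurableSet B) (hAB : A ⊆ B) (h : ν.real A = ν.real B) :
    G A = G B := by
  have := norm_sub_le_measureReal_sub hG hA hB hAB
  rw [h, sub_self] at this
  exact (sub_eq_zero.1 (norm_le_zero_iff.1 this)).symm

/-- The two sets are nested and of equal measure, and `G` is dominated by `ν`. With its companion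
for upper ends, this identifies averages over nodes with slopes of `t ↦ G (treeSet ν C t)`. -/
theorem apply_treeSet_measureReal_fst (hG : ∀ E, MeasurableSet E → ‖G E‖ ≤ ν.real E) (hε : 0 < ε)
    (hC : IsGapSystem G ν ε C) (h0 : 0 ≤ t) (h1 : t < 1) (n : ℕ) :
    G (treeSet ν C (ν.real (treeNode ν C t n).1)) = G (treeNode ν C t n).1 := by
  have hn := isNodeAt_treeNode hC h0 h1 n
  set s := ν.real (treeNode ν C t n).1 with hs
  have hs0 : 0 ≤ s := measureReal_nonneg
  have hs1 : s < 1 := hn.4.trans_lt h1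
  -- Nodes are closed on the left, so the lower end `s` belongs to the same node as `t`.
  have hnode : treeNode ν C s n = treeNode ν C t n := by
    rcases hn.4.eq_or_lt with h | h
    · rw [hs, h]
    · rcases treeNode_eq_or_subset hC hs0 h h1 n with h' | h'
      · exact h'
      · exact absurd (measureReal_mono h') (not_le.2 (isNodeAt_treeNode hC hs0 hs1 n).5)
  refine (eq_of_subset_of_measureReal_eq hG hn.1 (measurableSet_treeSet hC hs0) ?_ ?_).symm
  · rw [← hnode, treeSet, if_pos hs1]
    exact Set.subset_iUnion (fun n => (treeNode ν C s n).1) n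
  · rw [measureReal_treeSet hε hC hs0 hs1.le]

theorem apply_treeSet_measureReal_snd (hG : ∀ E, MeasurableSet E → ‖G E‖ ≤ ν.real E) (hε : 0 < ε)
    (hC : IsGapSystem G ν ε C) (h0 : 0 ≤ t) (h1 : t < 1) (n : ℕ) :
    G (treeSet ν C (ν.real (treeNode ν C t n).2)) = G (treeNode ν C t n).2 := by
  have hn := isNodeAt_treeNode hC h0 h1 n
  set s := ν.real (treeNode ν C t n).2 with hs
  have hs0 : 0 ≤ s := measureReal_nonneg
  have hs1 : s ≤ 1 := measureReal_le_one
  refine (eq_of_subset_of_measureReal_eq hG hn.2 (measurableSet_treeSet hC hs0) ?_ ?_).symm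
  -- Nodes are open on the right, so the upper end `s` already lies in a later node.
  · by_cases h : s < 1
    · rcases treeNode_eq_or_subset hC h0 hn.5 h n with h' | h'
      · have := (isNodeAt_treeNode hC hs0 h n).5
        rw [← h', ← hs] at this
        exact absurd this (lt_irrefl _)
      · rw [treeSet, if_pos h]
        exact h'.trans (Set.subset_iUnion (fun n => (treeNode ν C s n).1) n)
    · rw [treeSet, if_neg h]
      exact Set.subset_univ _
  · rw [measureReal_treeSet hε hC hs0 hs1]

theorem exists_oscillating_on_unitInterval (hG : ∀ E, MeasurableSet E → ‖G E‖ ≤ ν.real E)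
    (hε : 0 < ε) (hbad : ∀ E, MeasurableSet E → ν E ≠ 0 → ∀ y : Y,
      ∃ F ⊆ E, MeasurableSet F ∧ ε * ν.real F < ‖G F - ν.real F • y‖) :
    ∃ f : ℝ → Y, (∀ s t, 0 ≤ s → s ≤ t → t ≤ 1 → ‖f t - f s‖ ≤ t - s) ∧
      ∀ t, 0 ≤ t → t < 1 → ∃ a b : ℕ → ℝ, (∀ n, 0 ≤ a n) ∧ (∀ n, b n ≤ 1) ∧ (∀ n, a n ≤ t) ∧
        (∀ n, t < b n) ∧ Filter.Tendsto a Filter.atTop (nhds t) ∧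
        Filter.Tendsto b Filter.atTop (nhds t) ∧
        ∀ n, ε < ‖slope f (a (n + 1)) (b (n + 1)) - slope f (a n) (b n)‖ := by
  -- A chain is chosen for every pair, with a junk value for pairs that are not nested and
  -- measurable, so that `C` is a total function.
  have : ∀ A B : Set Ω, ∃ c : ℕ → Set Ω, MeasurableSet A → MeasurableSet B → A ⊆ B →
      IsGapChain G ν ε A B c := fun A B => by
    by_cases h : MeasurableSet A ∧ MeasurableSet B ∧ A ⊆ B
    · obtain ⟨c, hc⟩ := exists_isGapChain hG hbad h.1 h.2.1 h.2.2
      exact ⟨c, fun _ _ _ => hc⟩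
    · exact ⟨fun _ => ∅, fun h1 h2 h3 => absurd ⟨h1, h2, h3⟩ h⟩
  choose C hC using this
  replace hC : IsGapSystem G ν ε C := hC
  refine ⟨fun t => G (treeSet ν C t), fun s t h0 hst h1 => ?_, fun t h0 h1 => ?_⟩
  · refine (norm_sub_le_measureReal_sub hG (measurableSet_treeSet hC h0)
      (measurableSet_treeSet hC (h0.trans hst)) (treeSet_mono hC h0 hst)).trans_eq ?_
    rw [measureReal_treeSet hε hC h0 (hst.trans h1),
      measureReal_treeSet hε hC (h0.trans hst) h1]
  · have hn := isNodeAt_treeNode hC h0 h1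
    obtain ⟨ha, hb⟩ := tendsto_measureReal_treeNode hε hC h0 h1
    refine ⟨fun n => ν.real (treeNode ν C t n).1, fun n => ν.real (treeNode ν C t n).2,
      fun n => measureReal_nonneg, fun n => measureReal_le_one, fun n => (hn n).4,
      fun n => (hn n).5, ha, hb, fun n => ?_⟩
    have hslope : ∀ n, slope (fun t => G (treeSet ν C t)) (ν.real (treeNode ν C t n).1)
        (ν.real (treeNode ν C t n).2) =
        averageRate G ν (treeNode ν C t n).1 (treeNode ν C t n).2 := fun n => by
      rw [slope_def_module, apply_treeSet_measureReal_fst hG hε hC h0 h1,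
        apply_treeSet_measureReal_snd hG hε hC h0 h1, averageRate]
    rw [hslope, hslope]
    exact lt_norm_averageRate_treeNode_sub hC h0 h1 n

end

end Tree

/-! ### Oscillating slopes and nowhere differentiability -/

section Oscillation

variable {Y : Type*} [NormedAddCommGroup Y] [NormedSpace ℝ Y]

/-- `t` is the limit of a shrinking sequence of intervals around it on which the difference quotients
of `f` jump by more than `ε`. -/
def HasOscillatingSlopeAt (f : ℝ → Y) (ε t : ℝ) : Prop :=
  ∃ a b : ℕ → ℝ, (∀ n, a n ≤ t) ∧ (∀ n, t < b n) ∧ Filter.Tendsto a Filter.atTop (nhds t) ∧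
    Filter.Tendsto b Filter.atTop (nhds t) ∧
    ∀ n, ε < ‖slope f (a (n + 1)) (b (n + 1)) - slope f (a n) (b n)‖

/-- Straddle lemma: difference quotients over intervals shrinking to `t` and containing `t`
converge to the derivative at `t`. -/
theorem HasDerivAt.tendsto_slope_straddle {f : ℝ → Y} {f' : Y} {t : ℝ} (hf : HasDerivAt f f' t)
    {a b : ℕ → ℝ} (hat : ∀ n, a n ≤ t) (htb : ∀ n, t < b n)
    (ha : Filter.Tendsto a Filter.atTop (nhds t)) (hb : Filter.Tendsto b Filter.atTop (nhds t)) :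
    Filter.Tendsto (fun n => slope f (a n) (b n)) Filter.atTop (nhds f') := by
  rw [Metric.tendsto_nhds]
  intro η hη
  have h := hf.isLittleO.def (half_pos hη)
  filter_upwards [ha.eventually h, hb.eventually h] with n h1 h2
  have hpos : 0 < b n - a n := by linarith [hat n, htb n]
  have hkey : slope f (a n) (b n) - f' = (b n - a n)⁻¹ •
      ((f (b n) - f t - (b n - t) • f') - (f (a n) - f t - (a n - t) • f')) := by
    rw [slope_def_module]
    nth_rewrite 1 [← inv_smul_smul₀ hpos.ne' f']
    rw [← smul_sub]
    congr 1
    module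
  rw [dist_eq_norm, hkey, norm_smul, norm_inv, Real.norm_of_nonneg hpos.le, inv_mul_eq_div,
    div_lt_iff₀ hpos]
  rw [Real.norm_of_nonpos (by linarith [hat n])] at h1
  rw [Real.norm_of_nonneg (by linarith [htb n])] at h2
  calc _ ≤ η / 2 * (b n - t) + η / 2 * -(a n - t) := (norm_sub_le _ _).trans (add_le_add h2 h1)
    _ = η / 2 * (b n - a n) := by ring
    _ < η * (b n - a n) := by nlinarith

/-- The slopes of `h` are within `δ` of those of `f`, so they still jump by more than `ε - 2 * δ >
0`; at a point of differentiability they would converge. -/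
theorem HasOscillatingSlopeAt.not_differentiableAt {f h : ℝ → Y} {ε δ t : ℝ}
    (hf : HasOscillatingSlopeAt f ε t) (hδ : 2 * δ < ε)
    (hfh : ∀ x y, ‖(f x - h x) - (f y - h y)‖ ≤ δ * |x - y|) : ¬ DifferentiableAt ℝ h t := by
  intro hh
  obtain ⟨a, b, hat, htb, ha, hb, hosc⟩ := hf
  have hlim := hh.hasDerivAt.tendsto_slope_straddle hat htb ha hb
  have hd := ((hlim.comp (Filter.tendsto_add_atTop_nat 1)).sub hlim).norm
  rw [sub_self, norm_zero] at hd
  obtain ⟨n, hn⟩ := (hd.eventually (gt_mem_nhds (sub_pos.2 hδ))).exists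
  have hclose : ∀ n, ‖slope f (a n) (b n) - slope h (a n) (b n)‖ ≤ δ := fun n => by
    have hpos : 0 < b n - a n := by linarith [hat n, htb n]
    have := hfh (b n) (a n)
    rw [abs_of_pos hpos] at this
    rw [slope_def_module, slope_def_module, ← smul_sub, norm_smul, norm_inv,
      Real.norm_of_nonneg hpos.le, inv_mul_eq_div, div_le_iff₀ hpos]
    refine le_of_eq_of_le ?_ this
    congr 1
    abel
  have h1 := hosc n
  have h2 := hclose n
  have h3 := hclose (n + 1)
  have h4 : slope f (a (n + 1)) (b (n + 1)) - slope f (a n) (b n) =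
      (slope f (a (n + 1)) (b (n + 1)) - slope h (a (n + 1)) (b (n + 1)))
      - (slope f (a n) (b n) - slope h (a n) (b n))
      + (slope h (a (n + 1)) (b (n + 1)) - slope h (a n) (b n)) := by abel
  rw [h4] at h1
  have h5 := norm_add_le ((slope f (a (n + 1)) (b (n + 1)) - slope h (a (n + 1)) (b (n + 1)))
      - (slope f (a n) (b n) - slope h (a n) (b n)))
      (slope h (a (n + 1)) (b (n + 1)) - slope h (a n) (b n))
  have h6 := norm_sub_le (slope f (a (n + 1)) (b (n + 1)) - slope h (a (n + 1)) (b (n + 1)))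
      (slope f (a n) (b n) - slope h (a n) (b n))
  simp only [Function.comp] at hn
  linarith

/-- The extension of `f : [0, 1] → Y` to the line with increments of period one. -/
noncomputable def unitTiling (f : ℝ → Y) (x : ℝ) : Y :=
  (⌊x⌋ : ℝ) • (f 1 - f 0) + f (Int.fract x)

/-- Validity at the right endpoint too is what makes neighbouring copies fit together. -/
theorem unitTiling_eq (f : ℝ → Y) (k : ℤ) {x : ℝ} (h0 : (k : ℝ) ≤ x) (h1 : x ≤ k + 1) :
    unitTiling f x = (k : ℝ) • (f 1 - f 0) + f (x - k) := by
  rcases h1.eq_or_lt with rfl | h1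
  · have : ((k : ℝ) + 1) = ((k + 1 : ℤ) : ℝ) := by push_cast; rfl
    rw [unitTiling, this, Int.floor_intCast, Int.fract_intCast]
    push_cast
    rw [add_sub_cancel_left]
    module
  · have : ⌊x⌋ = k := Int.floor_eq_iff.2 ⟨h0, h1⟩
    rw [unitTiling, Int.fract, this]

theorem norm_unitTiling_sub_le {f : ℝ → Y}
    (hf : ∀ s t, 0 ≤ s → s ≤ t → t ≤ 1 → ‖f t - f s‖ ≤ t - s) {s t : ℝ} (hst : s ≤ t) :
    ‖unitTiling f t - unitTiling f s‖ ≤ t - s := by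
  have hloc : ∀ (k : ℤ) (x y : ℝ), (k : ℝ) ≤ x → x ≤ y → y ≤ k + 1 →
      ‖unitTiling f y - unitTiling f x‖ ≤ y - x := fun k x y h0 hxy h1 => by
    rw [unitTiling_eq f k h0 (hxy.trans h1), unitTiling_eq f k (h0.trans hxy) h1,
      add_sub_add_left_eq_sub]
    refine (hf _ _ (by linarith) (by linarith) (by linarith)).trans_eq (by ring)
  rcases (Int.floor_mono hst).eq_or_lt with h | h
  · exact hloc ⌊s⌋ s t (Int.floor_le s) hst (by rw [h]; exact (Int.lt_floor_add_one t).le)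
  · have h1 := hloc ⌊s⌋ s (⌊s⌋ + 1) (Int.floor_le s) (Int.lt_floor_add_one s).le le_rfl
    have h2 := hloc ⌊t⌋ ⌊t⌋ t le_rfl (Int.floor_le t) (Int.lt_floor_add_one t).le
    have hmk : ((⌊s⌋ : ℝ) + 1) ≤ ⌊t⌋ := by exact_mod_cast h
    -- Between integers the tiling grows by multiples of `f 1 - f 0`, of norm at most one.
    have h3 : ‖unitTiling f ⌊t⌋ - unitTiling f (⌊s⌋ + 1)‖ ≤ ⌊t⌋ - (⌊s⌋ + 1) := by
      rw [unitTiling_eq f ⌊t⌋ le_rfl (by linarith), unitTiling_eq f ⌊s⌋ (by linarith) le_rfl]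
      have hf1 := hf 0 1 le_rfl zero_le_one le_rfl
      have : (⌊t⌋ : ℝ) • (f 1 - f 0) + f (⌊t⌋ - ⌊t⌋) - ((⌊s⌋ : ℝ) • (f 1 - f 0) + f (⌊s⌋ + 1 - ⌊s⌋))
          = ((⌊t⌋ : ℝ) - (⌊s⌋ + 1)) • (f 1 - f 0) := by
        rw [sub_self, add_sub_cancel_left]
        module
      rw [this, norm_smul, Real.norm_of_nonneg (by linarith)]
      nlinarith
    calc ‖unitTiling f t - unitTiling f s‖
        = ‖(unitTiling f t - unitTiling f ⌊t⌋) + (unitTiling f ⌊t⌋ - unitTiling f (⌊s⌋ + 1))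
          + (unitTiling f (⌊s⌋ + 1) - unitTiling f s)‖ := by congr 1; abel
      _ ≤ (t - ⌊t⌋) + (⌊t⌋ - (⌊s⌋ + 1)) + (⌊s⌋ + 1 - s) :=
        (norm_add_le _ _).trans (add_le_add ((norm_add_le _ _).trans (add_le_add h2 h3)) h1)
      _ = t - s := by ring

theorem hasOscillatingSlopeAt_unitTiling {f : ℝ → Y} {ε : ℝ}
    (hf : ∀ t, 0 ≤ t → t < 1 → ∃ a b : ℕ → ℝ, (∀ n, 0 ≤ a n) ∧ (∀ n, b n ≤ 1) ∧ (∀ n, a n ≤ t) ∧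
        (∀ n, t < b n) ∧ Filter.Tendsto a Filter.atTop (nhds t) ∧
        Filter.Tendsto b Filter.atTop (nhds t) ∧
        ∀ n, ε < ‖slope f (a (n + 1)) (b (n + 1)) - slope f (a n) (b n)‖) (x : ℝ) :
    HasOscillatingSlopeAt (unitTiling f) ε x := by
  obtain ⟨a, b, ha0, hb1, hat, htb, ha, hb, hosc⟩ :=
    hf (Int.fract x) (Int.fract_nonneg x) (Int.fract_lt_one x)
  have hx : (⌊x⌋ : ℝ) + Int.fract x = x := Int.floor_add_fract x
  refine ⟨fun n => ⌊x⌋ + a n, fun n => ⌊x⌋ + b n, fun n => by linarith [hat n],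
    fun n => by linarith [htb n], ?_, ?_, fun n => ?_⟩
  · simpa [hx] using ha.const_add (⌊x⌋ : ℝ)
  · simpa [hx] using hb.const_add (⌊x⌋ : ℝ)
  · have hslope : ∀ n, slope (unitTiling f) (⌊x⌋ + a n) (⌊x⌋ + b n) = slope f (a n) (b n) := fun n => by
      have := hat n
      have := htb n
      rw [slope_def_module, slope_def_module,
        unitTiling_eq f ⌊x⌋ (by linarith [ha0 n]) (by linarith [hb1 n]),
        unitTiling_eq f ⌊x⌋ (by linarith [ha0 n]) (by linarith [hb1 n]),
        add_sub_add_left_eq_sub, add_sub_add_left_eq_sub, add_sub_cancel_left, add_sub_cancel_left]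
    rw [hslope, hslope]
    exact hosc n

end Oscillation

/-! ### Small oscillation on a non-null set -/

section SmallOscillation

variable {Ω : Type*} [MeasurableSpace Ω] {Y : Type*} [NormedAddCommGroup Y] [NormedSpace ℝ Y]

/-- If functions with a point of differentiability are dense in `Lip₀(ℝ, Y)`, then a vector measure
dominated by a probability measure has nearly constant average on the subsets of some non-null
set. -/
theorem exists_small_oscillation_of_isProbabilityMeasure
    (hdense : Dense {f : LipZero ℝ Y | ∃ t : ℝ, DifferentiableAt ℝ f t})
    {ν : Measure Ω} [IsProbabilityMeasure ν] {G : VectorMeasure Ω Y}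
    (hG : ∀ E, MeasurableSet E → ‖G E‖ ≤ ν.real E) {ε : ℝ} (hε : 0 < ε) :
    ∃ E, MeasurableSet E ∧ ν E ≠ 0 ∧ ∃ y : Y, ∀ F ⊆ E, MeasurableSet F →
      ‖G F - ν.real F • y‖ ≤ ε * ν.real F := by
  by_contra! hbad
  obtain ⟨f, hf, hosc⟩ := exists_oscillating_on_unitInterval hG hε hbad
  have hlip : LipschitzWith 1 fun x => unitTiling f x - unitTiling f 0 := by
    refine LipschitzWith.of_dist_le_mul fun x y => ?_
    rw [dist_eq_norm, sub_sub_sub_cancel_right, NNReal.coe_one, one_mul, Real.dist_eq]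
    rcases le_total x y with h | h
    · rw [norm_sub_rev, abs_sub_comm, abs_of_nonneg (sub_nonneg.2 h)]
      exact norm_unitTiling_sub_le hf h
    · rw [abs_of_nonneg (sub_nonneg.2 h)]
      exact norm_unitTiling_sub_le hf h
  -- Any radius below `ε / 2` would keep the slopes of `h` jumping.
  obtain ⟨h, ⟨t, ht⟩, hdist⟩ := hdense.exists_dist_lt
    (⟨fun x => unitTiling f x - unitTiling f 0, ⟨1, hlip⟩, sub_self _⟩ : LipZero ℝ Y)
    (show 0 < ε / 4 by positivity)
  rw [dist_eq_norm] at hdist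
  refine (hasOscillatingSlopeAt_unitTiling hosc t).not_differentiableAt (δ := ε / 4)
    (by linarith) (fun x y => ?_) ht
  have := LipZero.norm_sub_le_mul
    ((⟨fun x => unitTiling f x - unitTiling f 0, ⟨1, hlip⟩, sub_self _⟩ : LipZero ℝ Y) - h) x y
  simp only [LipZero.sub_apply] at this
  refine le_trans (le_of_eq ?_) (this.trans (mul_le_mul_of_nonneg_right hdist.le (norm_nonneg _)))
  congr 1
  abel

/-- Condition `ν` on `E` and rescale `G` by the same factor `(ν.real E)⁻¹`; the inequalities are
homogeneous. -/
theorem exists_small_oscillation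
    (hdense : Dense {f : LipZero ℝ Y | ∃ t : ℝ, DifferentiableAt ℝ f t})
    {ν : Measure Ω} [IsFiniteMeasure ν] {G : VectorMeasure Ω Y}
    (hG : ∀ E, MeasurableSet E → ‖G E‖ ≤ ν.real E) {ε : ℝ} (hε : 0 < ε) {E : Set Ω}
    (hE : MeasurableSet E) (hE0 : ν E ≠ 0) :
    ∃ F ⊆ E, MeasurableSet F ∧ ν F ≠ 0 ∧ ∃ y : Y, ∀ F' ⊆ F, MeasurableSet F' →
      ‖G F' - ν.real F' • y‖ ≤ ε * ν.real F' := by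
  have hprob : IsProbabilityMeasure (ProbabilityTheory.cond ν E) :=
    ProbabilityTheory.cond_isProbabilityMeasure hE0
  have hpos : 0 < ν.real E := ENNReal.toReal_pos hE0 (measure_ne_top _ _)
  have hcond : ∀ F, MeasurableSet F →
      (ProbabilityTheory.cond ν E).real F = (ν.real E)⁻¹ * ν.real (E ∩ F) := fun F _ => by
    rw [Measure.real, ProbabilityTheory.cond_apply hE, ENNReal.toReal_mul, ENNReal.toReal_inv]
    rfl
  have hG' : ∀ F, MeasurableSet F → ((ν.real E)⁻¹ • G.restrict E) F = (ν.real E)⁻¹ • G (E ∩ F) := by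
    intro F hF
    rw [FunLike.coe_smul, Pi.smul_apply, VectorMeasure.restrict_apply _ hE hF, Set.inter_comm]
  obtain ⟨F, hF, hF0, y, hy⟩ := exists_small_oscillation_of_isProbabilityMeasure hdense
    (ν := ProbabilityTheory.cond ν E) (G := (ν.real E)⁻¹ • G.restrict E) (fun F hF => by
      rw [hcond F hF, hG' F hF, norm_smul, norm_inv, Real.norm_of_nonneg hpos.le]
      exact mul_le_mul_of_nonneg_left (hG _ (hE.inter hF)) (inv_nonneg.2 hpos.le)) hε
  refine ⟨E ∩ F, Set.inter_subset_left, hE.inter hF, fun h0 => hF0 ?_, y, fun F' hF' hm => ?_⟩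
  · rw [ProbabilityTheory.cond_apply hE, h0, mul_zero]
  · have := hy F' (hF'.trans Set.inter_subset_right) hm
    rw [hcond F' hm, hG' F' hm, Set.inter_eq_right.2 (hF'.trans Set.inter_subset_left), mul_smul,
      ← smul_sub, norm_smul, norm_inv, Real.norm_of_nonneg hpos.le, mul_left_comm] at this
    exact le_of_mul_le_mul_left this (inv_pos.2 hpos)

end SmallOscillation

/-! ### From small oscillation to a density -/

section Gluing

variable {Ω : Type*} [MeasurableSpace Ω] {Y : Type*} [NormedAddCommGroup Y]

/-- A bound for a vector measure on the subsets of the pieces of a countable partition holds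
everywhere. -/
theorem VectorMeasure.norm_le_of_forall_subset_piece {ν : Measure Ω} [IsFiniteMeasure ν]
    {H : VectorMeasure Ω Y} (hnull : ∀ E, MeasurableSet E → ν E = 0 → H E = 0) {ε : ℝ}
    {F : ℕ → Set Ω} (hFm : ∀ i, MeasurableSet (F i)) (hFd : Pairwise (Function.onFun Disjoint F))
    (hF0 : ν (Set.univ \ ⋃ i, F i) = 0)
    (hF : ∀ i, ∀ F' ⊆ F i, MeasurableSet F' → ‖H F'‖ ≤ ε * ν.real F')
    {E : Set Ω} (hE : MeasurableSet E) : ‖H E‖ ≤ ε * ν.real E := by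
  have hm : ∀ i, MeasurableSet (E ∩ F i) := fun i => hE.inter (hFm i)
  have hd : Pairwise (Function.onFun Disjoint fun i => E ∩ F i) := fun i j hij =>
    (hFd hij).mono Set.inter_subset_right Set.inter_subset_right
  have hU : MeasurableSet (⋃ i, E ∩ F i) := MeasurableSet.iUnion hm
  have hUE : (⋃ i, E ∩ F i) ⊆ E := Set.iUnion_subset fun i => Set.inter_subset_left
  have hrest : ν (E \ ⋃ i, E ∩ F i) = 0 := by
    refine measure_mono_null ?_ hF0
    rw [← Set.inter_iUnion]
    exact fun x hx => ⟨trivial, fun hx' => hx.2 ⟨hx.1, hx'⟩⟩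
  have h1 : H (⋃ i, E ∩ F i) = H E := by
    have := H.of_sdiff hU hE hUE
    rw [hnull _ (hE.diff hU) hrest] at this
    exact (sub_eq_zero.1 this.symm).symm
  have h2 : ν.real (⋃ i, E ∩ F i) = ν.real E := by
    have := measureReal_sdiff (μ := ν) hUE hU
    rw [Measure.real, hrest, ENNReal.toReal_zero] at this
    linarith
  have s1 := H.hasSum_of_disjoint_iUnion hm hd
  have s2 := ν.toSignedMeasure.hasSum_of_disjoint_iUnion hm hd
  simp only [Measure.toSignedMeasure_apply_measurable, hm, hU] at s2
  rw [h1] at s1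
  rw [h2] at s2
  exact s1.norm_le_of_bounded (s2.mul_left ε) fun i => hF i _ Set.inter_subset_right (hm i)

variable [NormedSpace ℝ Y] [CompleteSpace Y]

/-- A vector measure with locally small oscillation is close to one with a density. -/
theorem exists_integrable_norm_sub_le {ν : Measure Ω} [IsFiniteMeasure ν] {G : VectorMeasure Ω Y}
    (hG : ∀ E, MeasurableSet E → ‖G E‖ ≤ ν.real E) {ε : ℝ}
    (hsmall : ∀ E, MeasurableSet E → ν E ≠ 0 → ∃ F ⊆ E, MeasurableSet F ∧ ν F ≠ 0 ∧
      ∃ y : Y, ∀ F' ⊆ F, MeasurableSet F' → ‖G F' - ν.real F' • y‖ ≤ ε * ν.real F') :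
    ∃ g : Ω → Y, Integrable g ν ∧
      ∀ E, MeasurableSet E → ‖G E - ∫ ω in E, g ω ∂ν‖ ≤ ε * ν.real E := by
  obtain ⟨F, hFm, hFd, -, hFP, hF0⟩ := exists_seq_disjoint_exhausting ν
    (P := fun F => ∃ y : Y, ∀ F' ⊆ F, MeasurableSet F' → ‖G F' - ν.real F' • y‖ ≤ ε * ν.real F')
    MeasurableSet.univ fun E _ hE hE0 => hsmall E hE hE0
  have hy : ∀ i, ∃ y : Y, ∀ F' ⊆ F i, MeasurableSet F' →
      ‖G F' - ν.real F' • y‖ ≤ ε * ν.real F' := fun i => by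
    rcases hFP i with h | h
    · refine ⟨0, fun F' hF' _ => ?_⟩
      rw [h, Set.subset_empty_iff] at hF'
      simp [hF']
    · exact h
  choose y hy using hy
  -- `k` gives the index of the piece containing a point, so `y ∘ k` is the step function with value
  -- `y i` on `F i`.
  obtain ⟨k, hk, hkF⟩ := exists_measurable_piecewise F hFm (fun i _ => i)
    (fun _ => measurable_const) fun i j hij ω hω =>
      absurd hω.2 (Set.disjoint_left.1 (hFd hij) hω.1)
  have hmeas : StronglyMeasurable (y ∘ k) := StronglyMeasurable.of_discrete.comp_measurable hk
  -- On null pieces `y i` is unconstrained, so only an almost everywhere bound is available.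
  have hbound : ∀ i, ν (F i) ≠ 0 → ‖y i‖ ≤ 1 + ε := fun i hi => by
    have hpos : 0 < ν.real (F i) := ENNReal.toReal_pos hi (measure_ne_top _ _)
    have h1 := hy i (F i) le_rfl (hFm i)
    have h2 := hG _ (hFm i)
    have h3 : ν.real (F i) * ‖y i‖ ≤ ν.real (F i) * (1 + ε) := by
      rw [← Real.norm_of_nonneg hpos.le, ← norm_smul, Real.norm_of_nonneg hpos.le]
      have h4 : ν.real (F i) • y i = G (F i) - (G (F i) - ν.real (F i) • y i) := by abel
      rw [h4]
      linarith [norm_sub_le (G (F i)) (G (F i) - ν.real (F i) • y i)]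
    exact le_of_mul_le_mul_left h3 hpos
  have hint : Integrable (y ∘ k) ν := by
    refine Integrable.of_bound hmeas.aestronglyMeasurable (1 + ε) ?_
    have h1 : ∀ᵐ ω ∂ν, ω ∈ ⋃ i, F i := by
      rw [ae_iff]
      convert hF0 using 2
      ext
      simp
    have h2 : ∀ᵐ ω ∂ν, ∀ i, ν (F i) = 0 → ω ∉ F i := by
      rw [ae_all_iff]
      intro i
      by_cases h : ν (F i) = 0
      · filter_upwards [measure_eq_zero_iff_ae_notMem.1 h] with ω hω _ using hω
      · exact Filter.Eventually.of_forall fun ω h' => absurd h' h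
    filter_upwards [h1, h2] with ω hω hω'
    obtain ⟨i, hi⟩ := Set.mem_iUnion.1 hω
    rw [Function.comp_apply, hkF i hi]
    exact hbound i fun h => hω' i h hi
  refine ⟨y ∘ k, hint, fun E hE => ?_⟩
  have hH : ∀ E, MeasurableSet E → (G - ν.withDensityᵥ (y ∘ k)) E = G E - ∫ ω in E, (y ∘ k) ω ∂ν :=
    fun E hE => by rw [FunLike.coe_sub, Pi.sub_apply, withDensityᵥ_apply hint hE]
  rw [← hH E hE]
  refine VectorMeasure.norm_le_of_forall_subset_piece (fun E hE h0 => ?_) hFm hFd hF0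
    (fun i F' hF' hm => ?_) hE
  · have := hG E hE
    rw [Measure.real, h0, ENNReal.toReal_zero, norm_le_zero_iff] at this
    rw [hH E hE, this, Measure.restrict_eq_zero.2 h0, integral_zero_measure, sub_zero]
  · rw [hH F' hm, setIntegral_congr_fun hm (g := fun _ => y i), setIntegral_const]
    · exact hy i F' hF' hm
    · intro ω hω
      rw [Function.comp_apply, hkF i (hF' hω)]

/-- The left side is the total variation of the measure with density `g - h`, and variation is the
least measure dominating the norm. -/
theorem lintegral_edist_le_of_forall_setIntegral {ν : Measure Ω} [IsFiniteMeasure ν] {g h : Ω → Y}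
    (hg : Integrable g ν) (hh : Integrable h ν) {c : ℝ}
    (hc : ∀ E, MeasurableSet E → ‖∫ ω in E, g ω ∂ν - ∫ ω in E, h ω ∂ν‖ ≤ c * ν.real E) :
    ∫⁻ ω, edist (g ω) (h ω) ∂ν ≤ ENNReal.ofReal c * ν Set.univ := by
  have hv := VectorMeasure.variation_le_of_forall_enorm_le (μ := ν.withDensityᵥ (g - h))
    (m := ENNReal.ofReal c • ν) fun E hE => by
      rw [withDensityᵥ_apply (hg.sub hh) hE, Measure.smul_apply, smul_eq_mul]
      simp only [Pi.sub_apply]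
      rw [integral_sub hg.integrableOn hh.integrableOn, ← ofReal_norm,
        ← ENNReal.ofReal_toReal (measure_ne_top ν E), ← ENNReal.ofReal_mul' ENNReal.toReal_nonneg]
      exact ENNReal.ofReal_le_ofReal (hc E hE)
  rw [Measure.variation_withDensityᵥ (hg.sub hh)] at hv
  have := hv Set.univ
  rw [withDensity_apply _ MeasurableSet.univ, Measure.restrict_univ] at this
  simpa only [edist_eq_enorm_sub, Pi.sub_apply, Measure.smul_apply, smul_eq_mul] using this

/-- Approximate densities with errors `1 / (n + 1)` form a Cauchy sequence in `L¹`, and integration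
over a fixed set is continuous there. -/
theorem exists_integrable_eq_setIntegral {ν : Measure Ω} [IsFiniteMeasure ν] {G : VectorMeasure Ω Y}
    (hG : ∀ E, MeasurableSet E → ‖G E‖ ≤ ν.real E)
    (hsmall : ∀ ε : ℝ, 0 < ε → ∀ E, MeasurableSet E → ν E ≠ 0 → ∃ F ⊆ E, MeasurableSet F ∧ ν F ≠ 0 ∧
      ∃ y : Y, ∀ F' ⊆ F, MeasurableSet F' → ‖G F' - ν.real F' • y‖ ≤ ε * ν.real F') :
    ∃ g : Ω → Y, Integrable g ν ∧ ∀ E, MeasurableSet E → G E = ∫ ω in E, g ω ∂ν := by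
  choose g hg hgG using fun n : ℕ => exists_integrable_norm_sub_le hG
    (hsmall (1 / ((n : ℝ) + 1)) Nat.one_div_pos_of_nat)
  have hbound : ∀ N n m : ℕ, N ≤ n → N ≤ m → edist ((hg n).toL1 (g n)) ((hg m).toL1 (g m)) ≤
      ENNReal.ofReal (2 * (1 / ((N : ℝ) + 1))) * ν Set.univ := fun N n m hn hm => by
    rw [Integrable.edist_toL1_toL1]
    refine lintegral_edist_le_of_forall_setIntegral (hg n) (hg m) fun E hE => ?_
    have h1 := hgG n E hE
    have h2 := hgG m E hE
    have h3 : 1 / ((n : ℝ) + 1) * ν.real E ≤ 1 / ((N : ℝ) + 1) * ν.real E :=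
      mul_le_mul_of_nonneg_right (Nat.one_div_le_one_div hn) measureReal_nonneg
    have h4 : 1 / ((m : ℝ) + 1) * ν.real E ≤ 1 / ((N : ℝ) + 1) * ν.real E :=
      mul_le_mul_of_nonneg_right (Nat.one_div_le_one_div hm) measureReal_nonneg
    rw [← sub_sub_sub_cancel_left _ _ (G E)]
    linarith [norm_sub_le (G E - ∫ ω in E, g m ω ∂ν) (G E - ∫ ω in E, g n ω ∂ν)]
  have hlim : Filter.Tendsto (fun N : ℕ => ENNReal.ofReal (2 * (1 / ((N : ℝ) + 1))) * ν Set.univ)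
      Filter.atTop (nhds 0) := by
    have h := (ENNReal.tendsto_ofReal ((tendsto_one_div_add_atTop_nhds_zero_nat (𝕜 := ℝ)).const_mul 2))
    rw [mul_zero, ENNReal.ofReal_zero] at h
    simpa using ENNReal.Tendsto.mul_const h (Or.inr (measure_ne_top ν Set.univ))
  have hcauchy : CauchySeq fun n => (hg n).toL1 (g n) := by
    rw [EMetric.cauchySeq_iff]
    intro η hη
    obtain ⟨N, hN⟩ := (hlim.eventually (gt_mem_nhds hη)).exists
    exact ⟨N, fun m hm n hn => (hbound N m n hm hn).trans_lt hN⟩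
  obtain ⟨φ, hφ⟩ := cauchySeq_tendsto_of_complete hcauchy
  refine ⟨φ, L1.integrable_coeFn φ, fun E hE => ?_⟩
  have h1 := ((continuous_setIntegral E).tendsto φ).comp hφ
  have h2 : ∀ n, ∫ ω in E, (hg n).toL1 (g n) ω ∂ν = ∫ ω in E, g n ω ∂ν := fun n =>
    integral_congr_ae (ae_restrict_of_ae (hg n).coeFn_toL1)
  have h3 : Filter.Tendsto (fun n => ∫ ω in E, g n ω ∂ν) Filter.atTop (nhds (G E)) := by
    rw [tendsto_iff_norm_sub_tendsto_zero]
    refine squeeze_zero (fun n => norm_nonneg _) (fun n => ?_)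
      (by simpa using (tendsto_one_div_add_atTop_nhds_zero_nat (𝕜 := ℝ)).mul_const (ν.real E))
    rw [norm_sub_rev]
    simpa using hgG n E hE
  refine tendsto_nhds_unique h3 ?_
  simpa only [Function.comp_def, h2] using h1

/-- A density is found with respect to the variation of `G`, which dominates `G`; since the
variation is absolutely continuous with respect to `μ`, multiplying by its scalar derivative gives
the density for `μ`. -/
theorem hasRadonNikodymProperty_of_dense_differentiable (Y : Type u) [NormedAddCommGroup Y]
    [NormedSpace ℝ Y] [CompleteSpace Y]
    (hdense : Dense {f : LipZero ℝ Y | ∃ t : ℝ, DifferentiableAt ℝ f t}) :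
    HasRadonNikodymProperty.{u, v} Y := by
  intro Ω _ μ _ G hvar hac
  have : IsFiniteMeasure G.variation := ⟨hvar⟩
  have hG : ∀ E, MeasurableSet E → ‖G E‖ ≤ G.variation.real E := fun E _ =>
    VectorMeasure.norm_measure_le_variation
  obtain ⟨g, hg, hgG⟩ := exists_integrable_eq_setIntegral hG fun ε hε E hE hE0 =>
    exists_small_oscillation hdense hG hε hE hE0
  have hvμ : G.variation ≪ μ := Measure.AbsolutelyContinuous.mk fun E hE h0 => by
    rw [VectorMeasure.variation_apply_eq_zero hE]
    exact fun F hFE hF => hac F hF (measure_mono_null hFE h0)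
  refine ⟨fun ω => (G.variation.rnDeriv μ ω).toReal • g ω, (integrable_rnDeriv_smul_iff hvμ).2 hg,
    fun E hE => ?_⟩
  rw [setIntegral_rnDeriv_smul hvμ hE]
  exact hgG E hE

end Gluing

/-! ### Densities of Lipschitz functions -/

section DensityOfLipschitz

variable {Y : Type u} [NormedAddCommGroup Y] [NormedSpace ℝ Y]

/-- The property is applied to the line, which lives in universe `0`; `ULift` carries it there. -/
theorem HasRadonNikodymProperty.of_ulift (hY : HasRadonNikodymProperty.{u, v} Y) :
    HasRadonNikodymProperty.{u, 0} Y := by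
  intro Ω _ μ _ G hvar hac
  have he : Measurable (MeasurableEquiv.ulift.{0, v} (α := Ω)).symm := MeasurableEquiv.measurable _
  obtain ⟨g, hg, hgG⟩ := hY (ULift.{v} Ω) (μ.map MeasurableEquiv.ulift.symm)
    (G.map MeasurableEquiv.ulift.symm) (by
      refine (VectorMeasure.variation_map_le Set.univ).trans_lt ?_
      rwa [Measure.map_apply he MeasurableSet.univ, Set.preimage_univ])
    (fun E hE h0 => by
      rw [Measure.map_apply he hE] at h0
      rw [VectorMeasure.map_apply _ he hE]
      exact hac _ (he hE) h0)
  refine ⟨g ∘ MeasurableEquiv.ulift.symm,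
    (MeasurableEquiv.ulift.symm.measurableEmbedding.integrable_map_iff).1 hg, fun E hE => ?_⟩
  have hE' : MeasurableSet (MeasurableEquiv.ulift.{0, v} (α := Ω) ⁻¹' E) :=
    MeasurableEquiv.ulift.measurable hE
  have := hgG _ hE'
  rw [VectorMeasure.map_apply _ he hE',
    MeasurableEquiv.ulift.symm.measurableEmbedding.setIntegral_map] at this
  exact this

/-- The nearest point projection of the line to `[a, b]`. -/
def clampTo (a b x : ℝ) : ℝ := max a (min b x)

theorem clampTo_of_mem {a b x : ℝ} (hx : x ∈ Set.Icc a b) : clampTo a b x = x := by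
  rw [clampTo, min_eq_right hx.2, max_eq_right hx.1]

theorem clampTo_mono {a b s t : ℝ} (hst : s ≤ t) : clampTo a b s ≤ clampTo a b t :=
  max_le_max le_rfl (min_le_min le_rfl hst)

theorem clampTo_sub_le {a b s t : ℝ} (hst : s ≤ t) : clampTo a b t - clampTo a b s ≤ t - s := by
  unfold clampTo
  grind

theorem volume_Ioc_inter_Ioc {a b s t : ℝ} (hab : a ≤ b) (hst : s ≤ t) :
    volume (Set.Ioc s t ∩ Set.Ioc a b) = ENNReal.ofReal (clampTo a b t - clampTo a b s) := by
  rw [Set.Ioc_inter_Ioc, Real.volume_Ioc]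
  unfold clampTo
  rcases le_total (t ⊓ b) (s ⊔ a) with h | h
  · rw [ENNReal.ofReal_of_nonpos (sub_nonpos.2 h), ENNReal.ofReal_of_nonpos]
    grind
  · congr 1
    grind

variable [CompleteSpace Y]

/-- In a space with the Radon–Nikodým property, a Lipschitz function on the line, cut off outside
`[a, b]`, is the integral of its density. -/
theorem HasRadonNikodymProperty.exists_density (hY : HasRadonNikodymProperty.{u, 0} Y) {f : ℝ → Y}
    {K : ℝ≥0} (hf : LipschitzWith K f) {a b : ℝ} (hab : a ≤ b) :
    ∃ g : ℝ → Y, StronglyMeasurable g ∧ Integrable g ∧ (∀ᵐ x, x ∉ Set.Ioc a b → g x = 0) ∧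
      ∀ s t, ∫ x in s..t, g x = f (clampTo a b t) - f (clampTo a b s) := by
  -- Increments of the cut-off function form an additive content on half-open intervals; domination
  -- by a multiple of Lebesgue measure on `(a, b]` lets it extend to a vector measure.
  have hA : ∀ S ∈ {S : Set ℝ | ∃ u v, u ≤ v ∧ S = Set.Ioc u v},
      ‖AddContent.onIoc (fun x => f (clampTo a b x)) S‖ₑ ≤ (K • volume.restrict (Set.Ioc a b)) S := by
    rintro S ⟨s, t, hst, rfl⟩
    rw [AddContent.onIoc_apply hst, Measure.smul_apply, Measure.restrict_apply measurableSet_Ioc,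
      volume_Ioc_inter_Ioc hab hst, ← edist_eq_enorm_sub]
    refine (hf.edist_le_mul _ _).trans_eq ?_
    rw [edist_dist, Real.dist_eq, abs_of_nonneg (sub_nonneg.2 (clampTo_mono hst))]
    rfl
  have hB : (inferInstance : MeasurableSpace ℝ) =
      MeasurableSpace.generateFrom {S : Set ℝ | ∃ u v, u ≤ v ∧ S = Set.Ioc u v} := by
    rw [BorelSpace.measurable_eq (α := ℝ), borel_eq_generateFrom_Ioc_le]
    refine congrArg MeasurableSpace.generateFrom (Set.ext fun S => ?_)
    exact ⟨fun ⟨l, u, h, e⟩ => ⟨l, u, h, e.symm⟩, fun ⟨l, u, h, e⟩ => ⟨l, u, h, e.symm⟩⟩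
  obtain ⟨m, hm, hmle⟩ := VectorMeasure.exists_extension_of_isSetSemiring_of_le_measure_of_generateFrom
    IsSetSemiring.Ioc hA hB
  obtain ⟨g, hg, hgm⟩ := hY ℝ (volume.restrict (Set.Ioc a b)) m
    ((VectorMeasure.variation_le_of_forall_enorm_le (fun E _ => hmle E) Set.univ).trans_lt
      (measure_lt_top _ _))
    (fun E _ h0 => by
      have := hmle E
      rwa [Measure.smul_apply, h0, smul_zero, nonpos_iff_eq_zero, enorm_eq_zero] at this)
  have hg' : Integrable ((Set.Ioc a b).indicator g) := (integrable_indicator_iff measurableSet_Ioc).2 hg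
  have hle : ∀ s t, s ≤ t → ∫ x in s..t, hg'.1.mk _ x = f (clampTo a b t) - f (clampTo a b s) := by
    intro s t hst
    rw [intervalIntegral.integral_of_le hst,
      ← integral_congr_ae (ae_restrict_of_ae hg'.1.ae_eq_mk), setIntegral_indicator measurableSet_Ioc,
      ← Measure.restrict_restrict measurableSet_Ioc, ← hgm _ measurableSet_Ioc, hm _ ⟨s, t, hst, rfl⟩,
      AddContent.onIoc_apply hst]
  refine ⟨hg'.1.mk _, hg'.1.stronglyMeasurable_mk, hg'.congr hg'.1.ae_eq_mk, ?_, fun s t => ?_⟩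
  · filter_upwards [hg'.1.ae_eq_mk] with x hx hx'
    rw [← hx, Set.indicator_of_notMem hx']
  · rcases le_total s t with h | h
    · exact hle s t h
    · rw [intervalIntegral.integral_symm, hle t s h, neg_sub]

omit [NormedSpace ℝ Y] [CompleteSpace Y] in
/-- A function which is not almost everywhere small in norm on a set is, on some non-null
measurable subset on which it is large, close to a constant. -/
theorem exists_nonnull_near_constant {g : ℝ → Y} (hg : StronglyMeasurable g) {a b c δ : ℝ}
    (hδ : 0 < δ) (h : ¬ ∀ᵐ x, x ∈ Set.Ioc a b → ‖g x‖ ≤ c) :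
    ∃ y : Y, ∃ B ⊆ Set.Ioo a b, MeasurableSet B ∧ volume B ≠ 0 ∧
      ∀ x ∈ B, c < ‖g x‖ ∧ dist (g x) y < δ := by
  obtain ⟨D, hDc, hD⟩ := hg.isSeparable_range
  by_contra! hcon
  refine h ?_
  -- Countably many balls centred in `D` cover the range of `g`, so if all these pieces were null,
  -- so would be the set where `g` is large.
  have hnull : ∀ᵐ x, ∀ y ∈ D, ¬ (x ∈ Set.Ioo a b ∧ c < ‖g x‖ ∧ dist (g x) y < δ) := by
    rw [ae_ball_iff hDc]
    intro y _
    by_contra hy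
    obtain ⟨x, ⟨-, hx2⟩, hx⟩ := hcon y {x | x ∈ Set.Ioo a b ∧ c < ‖g x‖ ∧ dist (g x) y < δ}
      (fun x hx => hx.1)
      (measurableSet_Ioo.inter ((measurableSet_lt measurable_const hg.norm.measurable).inter
        (measurableSet_lt (hg.dist stronglyMeasurable_const).measurable measurable_const)))
      (fun h0 => hy (measure_eq_zero_iff_ae_notMem.1 h0))
    exact absurd hx2.2 (not_lt.2 (hx hx2.1))
  filter_upwards [hnull, Measure.ae_ne volume b] with x hx hxb hxab
  by_contra! hlt
  obtain ⟨y, hy, hxy⟩ := Metric.mem_closure_iff.1 (hD (Set.mem_range_self x)) δ hδ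
  exact hx y hy ⟨⟨hxab.1, lt_of_le_of_ne hxab.2 hxb⟩, hlt, hxy⟩

omit [NormedSpace ℝ Y] [CompleteSpace Y] in
-- What remains is the increment of `f` over the part of `[s, t]` outside `[a, b]`, made of at most
-- two intervals.
theorem norm_sub_sub_clampTo_le {f : ℝ → Y} {K : ℝ} (hf : ∀ x y, ‖f x - f y‖ ≤ K * |x - y|)
    {a b s t : ℝ} (hab : a ≤ b) (hst : s ≤ t) :
    ‖(f t - f s) - (f (clampTo a b t) - f (clampTo a b s))‖ ≤
      K * ((t - s) - (clampTo a b t - clampTo a b s)) := by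
  have hK : 0 ≤ K := by simpa using (norm_nonneg _).trans (hf 0 1)
  have hle : ∀ x y, x ≤ y → ‖f y - f x‖ ≤ K * (y - x) := fun x y hxy => by
    simpa [abs_of_nonneg (sub_nonneg.2 hxy)] using hf y x
  have hcase : ∀ x, x ≤ a ∧ clampTo a b x = a ∨ (a ≤ x ∧ x ≤ b) ∧ clampTo a b x = x ∨
      b ≤ x ∧ clampTo a b x = b := fun x => by
    unfold clampTo
    grind
  rcases hcase s with ⟨hs, hs'⟩ | ⟨hs, hs'⟩ | ⟨hs, hs'⟩ <;>
    rcases hcase t with ⟨ht, ht'⟩ | ⟨ht, ht'⟩ | ⟨ht, ht'⟩ <;> rw [hs', ht']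
  · simpa using hle s t hst
  · have := hle s a hs
    convert this using 2 <;> abel
  · have h1 := hle s a hs
    have h2 := hle b t ht
    calc _ = ‖(f t - f b) + (f a - f s)‖ := by congr 1; abel
      _ ≤ K * (t - b) + K * (a - s) := (norm_add_le _ _).trans (add_le_add h2 h1)
      _ = _ := by ring
  · have : s = a := le_antisymm (hst.trans ht) hs.1
    subst this
    simpa using hle s t hst
  · simp
  · have := hle b t ht
    convert this using 2 <;> abel
  · have h1 : s = t := by linarith
    have h2 : a = b := by linarith
    simp [h1, h2]
  · have : t = b := le_antisymm ht.2 (hs.trans hst)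
    subst this
    simpa using hle s t hst
  · simpa using hle s t hst

omit [CompleteSpace Y] in
theorem norm_intervalIntegral_le_clampTo {w : ℝ → Y} {K a b s t : ℝ} (hab : a ≤ b) (hst : s ≤ t)
    (hw0 : ∀ᵐ x, x ∉ Set.Ioc a b → w x = 0) (hwK : ∀ᵐ x, ‖w x‖ ≤ K) :
    ‖∫ x in s..t, w x‖ ≤ K * (clampTo a b t - clampTo a b s) := by
  have hind : w =ᵐ[volume] (Set.Ioc a b).indicator w := by
    filter_upwards [hw0] with x hx
    by_cases h : x ∈ Set.Ioc a b
    · rw [Set.indicator_of_mem h]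
    · rw [Set.indicator_of_notMem h, hx h]
  have hvol := volume_Ioc_inter_Ioc hab hst
  rw [intervalIntegral.integral_of_le hst, integral_congr_ae (ae_restrict_of_ae hind),
    setIntegral_indicator measurableSet_Ioc]
  refine (norm_setIntegral_le_of_norm_le_const_ae' (by rw [hvol]; exact ENNReal.ofReal_lt_top)
    (C := K) (hwK.mono fun x hx _ => hx)).trans_eq ?_
  rw [Measure.real, hvol, ENNReal.toReal_ofReal (sub_nonneg.2 (clampTo_mono hst))]

/-- A density with a `K`-Lipschitz primitive is bounded by `K` almost everywhere. -/
theorem ae_norm_le_of_lipschitz_primitive {g : ℝ → Y} (hg : Integrable g) {K : ℝ≥0} {c : ℝ}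
    (hK : LipschitzWith K fun t => ∫ x in c..t, g x) : ∀ᵐ x, ‖g x‖ ≤ K := by
  filter_upwards [LocallyIntegrable.ae_hasDerivAt_integral hg.locallyIntegrable] with x hx
  exact (hx c).le_of_lipschitz hK

end DensityOfLipschitz

/-! ### Attaining the norm through a derivative -/

section NormAttaining

variable {Y : Type u} [NormedAddCommGroup Y] [NormedSpace ℝ Y]

theorem LipZero.lipschitzWith (f : LipZero ℝ Y) : LipschitzWith ‖f‖₊ f :=
  LipschitzWith.of_dist_le_mul fun x y => by
    rw [dist_eq_norm, dist_eq_norm]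
    exact f.norm_sub_le_mul x y

theorem LipZero.mem_derivAttaining_of_hasDerivAt {f : LipZero ℝ Y} {z : Y} {x : ℝ}
    (hf : HasDerivAt f z x) (hz : ‖f‖ ≤ ‖z‖) : f ∈ LipZero.derivAttaining ℝ Y := by
  refine ⟨x, 1, norm_one, z, ?_, le_antisymm (hf.le_of_lipschitz f.lipschitzWith) hz⟩
  simpa using hf.hasFDerivAt.hasLineDerivAt 1

omit [NormedSpace ℝ Y] in
theorem LipZero.exists_lt_norm_sub (f : LipZero ℝ Y) {c : ℝ} (h0 : 0 ≤ c) (hc : c < ‖f‖) :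
    ∃ a b, a < b ∧ c * (b - a) < ‖f b - f a‖ := by
  have : ∃ x y : ℝ, c * ‖x - y‖ < ‖f x - f y‖ := by
    by_contra! h
    exact absurd (f.norm_le_of_forall h0 h) (not_le.2 hc)
  obtain ⟨x, y, h⟩ := this
  rcases lt_trichotomy x y with hxy | rfl | hxy
  · refine ⟨x, y, hxy, ?_⟩
    rwa [norm_sub_rev, norm_sub_rev (f x), Real.norm_of_nonneg (sub_nonneg.2 hxy.le)] at h
  · simp at h
  · refine ⟨y, x, hxy, ?_⟩
    rwa [Real.norm_of_nonneg (sub_nonneg.2 hxy.le)] at h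

variable [CompleteSpace Y]

/-- The density of `f` is overwritten by a constant `z` on a non-null set where it was already close
to `z`. The distance `4 * δ` is `3 * δ` from `z` to `y` plus `δ` from `y` to `g`. -/
theorem HasRadonNikodymProperty.exists_derivAttaining_near (hY : HasRadonNikodymProperty.{u, 0} Y)
    (f : LipZero ℝ Y) {δ : ℝ} (hδ : 0 < δ) (hδf : 2 * δ < ‖f‖) :
    ∃ h ∈ LipZero.derivAttaining ℝ Y, ‖h - f‖ ≤ 4 * δ := by
  obtain ⟨a, b, hab, hfab⟩ := f.exists_lt_norm_sub (c := ‖f‖ - δ) (by linarith) (by linarith)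
  obtain ⟨g, hgm, hg, hg0, hgf⟩ := hY.exists_density f.lipschitzWith hab.le
  have hca : clampTo a b a = a := clampTo_of_mem ⟨le_rfl, hab.le⟩
  have hcb : clampTo a b b = b := clampTo_of_mem ⟨hab.le, le_rfl⟩
  have hgK : ∀ᵐ x, ‖g x‖ ≤ ‖f‖ := by
    refine ae_norm_le_of_lipschitz_primitive hg (K := ‖f‖₊) (c := a)
      (LipschitzWith.of_dist_le_mul fun s t => ?_)
    rw [hgf, hgf, dist_sub_right]
    refine (f.lipschitzWith.dist_le_mul _ _).trans (mul_le_mul_of_nonneg_left ?_ (norm_nonneg f))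
    rw [Real.dist_eq, Real.dist_eq]
    rcases le_total s t with hst | hst
    · rw [abs_sub_comm, abs_sub_comm s, abs_of_nonneg (sub_nonneg.2 hst),
        abs_of_nonneg (sub_nonneg.2 (clampTo_mono hst))]
      exact clampTo_sub_le hst
    · rw [abs_of_nonneg (sub_nonneg.2 hst), abs_of_nonneg (sub_nonneg.2 (clampTo_mono hst))]
      exact clampTo_sub_le hst
  -- Were `‖g‖ ≤ ‖f‖ - δ` almost everywhere on `(a, b]`, the increment of `f` would be too small.
  obtain ⟨y, B, hBab, hBm, hB0, hB⟩ := exists_nonnull_near_constant hgm hδ (a := a) (b := b)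
    (c := ‖f‖ - δ) (fun hsmall => by
      rw [← Set.uIoc_of_le hab.le] at hsmall
      have := intervalIntegral.norm_integral_le_of_norm_le_const_ae hsmall
      rw [hgf, hca, hcb, abs_of_nonneg (sub_nonneg.2 hab.le)] at this
      exact absurd hfab (not_lt.2 this))
  have hmeet : ∀ {p : ℝ → Prop}, (∀ᵐ x, p x) → ∃ x ∈ B, p x := fun {p} hp => by
    by_contra! hcon
    exact hB0 (measure_eq_zero_iff_ae_notMem.2 (hp.mono fun x hx hxB => hcon x hxB hx))
  have hy1 : ‖f‖ - 2 * δ < ‖y‖ := by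
    obtain ⟨x, hx, -⟩ := hmeet hgK
    have h1 := (hB x hx).1
    have h2 := (hB x hx).2
    rw [dist_eq_norm] at h2
    linarith [norm_le_norm_add_norm_sub' (g x) y]
  have hy2 : ‖y‖ < ‖f‖ + δ := by
    obtain ⟨x, hx, hxK⟩ := hmeet hgK
    have h2 := (hB x hx).2
    rw [dist_eq_norm] at h2
    linarith [norm_le_norm_add_norm_sub (g x) y]
  have hypos : 0 < ‖y‖ := by linarith
  -- Since `‖f‖ - 2 * δ < ‖y‖ < ‖f‖ + δ`, stretching `y` to norm `‖f‖ + δ` moves it by less than `3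
  -- * δ`.
  obtain ⟨z, hz, hzy⟩ : ∃ z : Y, ‖z‖ = ‖f‖ + δ ∧ ‖z - y‖ ≤ 3 * δ := by
    refine ⟨((‖f‖ + δ) / ‖y‖) • y, ?_, ?_⟩
    · rw [norm_smul, Real.norm_of_nonneg (by positivity), div_mul_cancel₀ _ hypos.ne']
    · have : ((‖f‖ + δ) / ‖y‖) • y - y = ((‖f‖ + δ - ‖y‖) / ‖y‖) • y := by
        rw [sub_div, div_self hypos.ne', sub_smul, one_smul]
      rw [this, norm_smul, Real.norm_of_nonneg (div_nonneg (by linarith) hypos.le),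
        div_mul_cancel₀ _ hypos.ne']
      linarith
  set w : ℝ → Y := B.indicator fun x => z - g x with hw
  have hwint : Integrable w := by
    refine (integrable_indicator_iff hBm).2 (Integrable.sub ?_ hg.integrableOn)
    exact integrableOn_const ((measure_mono hBab).trans_lt measure_Ioo_lt_top).ne
  have hw4 : ∀ x, ‖w x‖ ≤ 4 * δ := fun x => by
    by_cases hx : x ∈ B
    · rw [hw, Set.indicator_of_mem hx]
      have h2 := (hB x hx).2
      rw [dist_eq_norm, norm_sub_rev] at h2
      have := norm_add_le (z - y) (y - g x)
      rw [sub_add_sub_cancel] at this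
      linarith
    · rw [hw, Set.indicator_of_notMem hx, norm_zero]
      linarith
  have hPsub : ∀ s t, (∫ x in (0 : ℝ)..t, w x) - ∫ x in (0 : ℝ)..s, w x = ∫ x in s..t, w x :=
    fun s t => intervalIntegral.integral_interval_sub_left hwint.intervalIntegrable
      hwint.intervalIntegrable
  have hPle : ∀ s t, ‖(∫ x in (0 : ℝ)..s, w x) - ∫ x in (0 : ℝ)..t, w x‖ ≤ 4 * δ * ‖s - t‖ :=
    fun s t => by
      rw [hPsub]
      exact intervalIntegral.norm_integral_le_of_norm_le_const fun x _ => hw4 x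
  let P : LipZero ℝ Y := ⟨fun t => ∫ x in (0 : ℝ)..t, w x, ⟨⟨4 * δ, by positivity⟩,
    LipschitzWith.of_dist_le_mul fun s t => by
      rw [dist_eq_norm, dist_eq_norm]
      exact hPle s t⟩, intervalIntegral.integral_same⟩
  refine ⟨f + P, ?_, by
    rw [add_sub_cancel_left]
    exact P.norm_le_of_forall (by positivity) hPle⟩
  -- Outside `[a, b]` the increments are those of `f`; inside, the density is `g + w`, equal to `z`
  -- on `B` and to `g` elsewhere.
  have hle : ∀ s t, s ≤ t → ‖(f + P) t - (f + P) s‖ ≤ (‖f‖ + δ) * (t - s) := fun s t hst => by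
    have h1 := norm_sub_sub_clampTo_le (K := ‖f‖) (fun x y => f.norm_sub_le_mul x y) hab.le hst
    have h2 : ‖∫ x in s..t, (g x + w x)‖ ≤ (‖f‖ + δ) * (clampTo a b t - clampTo a b s) := by
      refine norm_intervalIntegral_le_clampTo hab.le hst ?_ ?_
      · filter_upwards [hg0] with x hx hxab
        rw [hx hxab, hw, Set.indicator_of_notMem fun hxB => hxab (Set.Ioo_subset_Ioc_self (hBab hxB)),
          add_zero]
      · filter_upwards [hgK] with x hx
        by_cases hxB : x ∈ B
        · rw [hw, Set.indicator_of_mem hxB, add_sub_cancel, hz]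
        · rw [hw, Set.indicator_of_notMem hxB, add_zero]
          linarith
    rw [intervalIntegral.integral_add hg.intervalIntegrable hwint.intervalIntegrable, hgf] at h2
    have h3 : (f + P) t - (f + P) s = ((f t - f s) - (f (clampTo a b t) - f (clampTo a b s))) +
        ((f (clampTo a b t) - f (clampTo a b s)) + ∫ x in s..t, w x) := by
      rw [← hPsub s t, LipZero.add_apply, LipZero.add_apply]
      change f t + (∫ x in (0 : ℝ)..t, w x) - (f s + ∫ x in (0 : ℝ)..s, w x) = _
      abel
    rw [h3]
    refine (norm_add_le _ _).trans ((add_le_add h1 h2).trans ?_)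
    nlinarith [clampTo_sub_le (a := a) (b := b) hst]
  -- Lebesgue differentiation holds almost everywhere, hence at some point of the non-null set `B`.
  obtain ⟨x, hxB, hxg, hxw⟩ := hmeet
    ((LocallyIntegrable.ae_hasDerivAt_integral hg.locallyIntegrable).and
      (LocallyIntegrable.ae_hasDerivAt_integral hwint.locallyIntegrable))
  refine LipZero.mem_derivAttaining_of_hasDerivAt (z := z) (x := x) ?_ ?_
  · have hf' : HasDerivAt f (g x) x := by
      refine ((hxg a).add_const (f a)).congr_of_eventuallyEq ?_
      filter_upwards [Ioo_mem_nhds (hBab hxB).1 (hBab hxB).2] with t ht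
      rw [hgf, hca, clampTo_of_mem (Set.Ioo_subset_Icc_self ht), sub_add_cancel]
    have := hf'.add (hxw 0)
    rwa [hw, Set.indicator_of_mem hxB, add_sub_cancel] at this
  · rw [hz]
    refine LipZero.norm_le_of_forall _ (by positivity) fun s t => ?_
    rcases le_total s t with hst | hst
    · rw [norm_sub_rev, norm_sub_rev s, Real.norm_of_nonneg (sub_nonneg.2 hst)]
      exact hle s t hst
    · rw [Real.norm_of_nonneg (sub_nonneg.2 hst)]
      exact hle t s hst

theorem HasRadonNikodymProperty.dense_derivAttaining (hY : HasRadonNikodymProperty.{u, v} Y) :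
    Dense (LipZero.derivAttaining ℝ Y) := by
  refine Metric.dense_iff.2 fun f r hr => ?_
  rcases (norm_nonneg f).eq_or_lt with hf | hf
  · have hf0 : f = 0 := norm_eq_zero.1 hf.symm
    subst hf0
    exact ⟨0, Metric.mem_ball_self hr,
      LipZero.mem_derivAttaining_of_hasDerivAt (hasDerivAt_const (0 : ℝ) (0 : Y)) (by simp)⟩
  -- `r / 8` makes `4 * δ < r`, and `‖f‖ / 4` makes `2 * δ < ‖f‖`.
  · obtain ⟨h, hh, hhf⟩ := hY.of_ulift.exists_derivAttaining_near f (δ := min (r / 8) (‖f‖ / 4))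
      (by positivity) (by linarith [min_le_right (r / 8) (‖f‖ / 4)])
    refine ⟨h, ?_, hh⟩
    rw [Metric.mem_ball, dist_eq_norm]
    linarith [min_le_left (r / 8) (‖f‖ / 4)]

omit [CompleteSpace Y] in
-- On the line a nonzero direction only rescales the parameter, so a directional derivative is an
-- ordinary one up to a factor.
theorem LipZero.exists_differentiableAt_of_mem_derivAttaining {f : LipZero ℝ Y}
    (hf : f ∈ LipZero.derivAttaining ℝ Y) : ∃ t : ℝ, DifferentiableAt ℝ f t := by
  obtain ⟨x, e, he, z, hz, -⟩ := hf
  have he0 : e ≠ 0 := fun h => by simp [h] at he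
  refine ⟨x, ?_⟩
  have hz' : HasDerivAt (fun t : ℝ => f (x + t • e)) z (e⁻¹ * (x - x)) := by
    rw [sub_self, mul_zero]
    exact hz
  have hg : HasDerivAt (fun s : ℝ => e⁻¹ * (s - x)) e⁻¹ x := by
    simpa using ((hasDerivAt_id x).sub_const x).const_mul e⁻¹
  have := (hz'.scomp x hg).differentiableAt
  have hcomp : ((fun t : ℝ => f (x + t • e)) ∘ fun s => e⁻¹ * (s - x)) = f := by
    funext s
    simp only [Function.comp_apply, smul_eq_mul]
    congr 1
    field_simp
    ring
  rwa [hcomp] at this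

end NormAttaining

theorem theorem3p1 (Y : Type u) [NormedAddCommGroup Y] [NormedSpace ℝ Y] [CompleteSpace Y] :
    List.TFAE
      [HasRadonNikodymProperty.{u, v} Y,
        Dense (LipZero.derivAttaining ℝ Y),
        Dense {f : LipZero ℝ Y | ∃ t : ℝ, DifferentiableAt ℝ f t}] := by
  tfae_have 1 → 2 := HasRadonNikodymProperty.dense_derivAttaining
  tfae_have 2 → 3 := fun h =>
    h.mono fun _ hf => LipZero.exists_differentiableAt_of_mem_derivAttaining hf
  tfae_have 3 → 1 := hasRadonNikodymProperty_of_dense_differentiable Y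
  tfae_finish
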